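/- Let $G$ be a finite simple graph that contains no triangle $K_3$ and no induced subgraph isomorphic to a subdivision of $K_4$, where a subdivision of a graph is obtained by replacing its edges with internally disjoint paths of arbitrary length (at least one). Then $\chi(G)\leq 4$. -/

import Mathlib

namespace SimpleGraph

/-- The data exhibiting `H` as a subdivision of `G`: `H` arises from `G` by replacing each edge
`uv` with a path of length at least one from `branch u` to `branch v` (a path between two distinct
vertices has positive length), where the paths meet only in branch vertices. -/
structure Subdivision {α β : Type*} (G : SimpleGraph α) (H : SimpleGraph β) where
  /-- The vertices of `H` that correspond to the vertices of `G`. -/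
  branch : α → β
  branch_injective : Function.Injective branch
  /-- The path of `H` that replaces an edge of `G`. -/
  path : ∀ {u v : α}, G.Adj u v → H.Walk (branch u) (branch v)
  path_isPath : ∀ {u v : α} (h : G.Adj u v), (path h).IsPath
  /-- There is one path for each undirected edge. -/
  path_symm : ∀ {u v : α} (h : G.Adj u v), path h.symm = (path h).reverse
  /-- A path contains no branch vertices but its two ends. -/
  branch_mem_path : ∀ {u v : α} (h : G.Adj u v) (x : α),
    branch x ∈ (path h).support → x = u ∨ x = v
  /-- Paths that replace distinct edges have no common interior vertex. -/
  path_disjoint : ∀ {u v u' v' : α} (h : G.Adj u v) (h' : G.Adj u' v'), s(u, v) ≠ s(u', v') →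
    ∀ w : β, w ∈ (path h).support → w ∈ (path h').support → w ∈ Set.range branch
  /-- `H` has no vertices besides the branch vertices and those of the paths. -/
  vertex_cover : ∀ w : β, w ∈ Set.range branch ∨
    ∃ (u v : α) (h : G.Adj u v), w ∈ (path h).support
  /-- `H` has no edges besides those of the paths. -/
  edge_cover : ∀ e ∈ H.edgeSet, ∃ (u v : α) (h : G.Adj u v), e ∈ (path h).edges

/-- `H` is (isomorphic to) a subdivision of `G`. -/
def IsSubdivision {α β : Type*} (G : SimpleGraph α) (H : SimpleGraph β) : Prop :=
  Nonempty (Subdivision G H)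

/-- No induced subgraph of `G` is a subdivision of the complete graph on four vertices. -/
def ISK4Free {V : Type*} (G : SimpleGraph V) : Prop :=
  ∀ S : Set V, ¬ IsSubdivision (⊤ : SimpleGraph (Fin 4)) (G.induce S)

end SimpleGraph


/-!
Layer a connected graph by the distance from a vertex. If every layer is bipartite, two pairs of
colours, alternating with the parity of the layer, suffice. Otherwise a shortest odd closed walk
inside a layer gives an induced odd cycle there. Each vertex of the layer above has at most one
neighbour on the cycle: two neighbours would, by parity, cut off an ear, an arc of the cycle of
length at least three to which the vertex is joined at the ends only, and a shortest ear in the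
graph already leads to an induced subdivision of `K₄`. So the parents of three consecutive vertices
of the cycle, connected through the layers above, form a connected set attached to the cycle by
exactly three edges. In a triangle-free graph such a set contains an induced claw, with arms of any
length, ending at the three parents, and it completes the cycle to an induced subdivision of `K₄`.
-/
section

open SimpleGraph

variable {V : Type*} {G : SimpleGraph V}

/-- Away from the vertex `m`, the sets `s` and `t` are disjoint and no edge joins them. -/
def MeetsOnlyAt (G : SimpleGraph V) (s t : Set V) (m : V) : Prop :=
  ∀ x ∈ s, ∀ y ∈ t, x = y ∨ G.Adj x y → x = m ∨ y = m

/-- The sets `s` and `t` are disjoint and joined by no edge, except possibly one from `a ∈ s` to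
`b ∈ t`. -/
def JoinedOnlyBy (G : SimpleGraph V) (s t : Set V) (a b : V) : Prop :=
  ∀ x ∈ s, ∀ y ∈ t, x ≠ y ∧ (G.Adj x y → x = a ∧ y = b)

theorem MeetsOnlyAt.symm {s t : Set V} {m : V} (h : MeetsOnlyAt G s t m) : MeetsOnlyAt G t s m :=
  fun x hx y hy hxy => (h y hy x hx (hxy.imp Eq.symm Adj.symm)).symm

theorem MeetsOnlyAt.mono {s s' t t' : Set V} {m : V} (h : MeetsOnlyAt G s t m) (hs : s' ⊆ s)
    (ht : t' ⊆ t) : MeetsOnlyAt G s' t' m :=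
  fun x hx y hy => h x (hs hx) y (ht hy)

theorem MeetsOnlyAt.eq_of_mem {s t : Set V} {m x : V} (h : MeetsOnlyAt G s t m) (hs : x ∈ s)
    (ht : x ∈ t) : x = m :=
  (h x hs x ht (.inl rfl)).elim id id

theorem JoinedOnlyBy.symm {s t : Set V} {a b : V} (h : JoinedOnlyBy G s t a b) :
    JoinedOnlyBy G t s b a :=
  fun x hx y hy => ⟨(h y hy x hx).1.symm, fun hxy => ((h y hy x hx).2 hxy.symm).symm⟩

/-- `IsIndPath G s u v`: the set `s` induces in `G` a path with ends `u` and `v`. -/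
inductive IsIndPath (G : SimpleGraph V) : Set V → V → V → Prop
  | single (v : V) : IsIndPath G {v} v v
  | cons {a b v : V} {s : Set V} : G.Adj a b → IsIndPath G s b v → a ∉ s →
      (∀ x ∈ s, G.Adj a x → x = b) → IsIndPath G (insert a s) a v

namespace IsIndPath

variable {s t : Set V} {u v m n b c : V}

theorem left_mem (h : IsIndPath G s u v) : u ∈ s := by
  cases h <;> simp

theorem right_mem (h : IsIndPath G s u v) : v ∈ s := by
  induction h with
  | single => rfl
  | cons _ _ _ _ ih => exact .inr ih

theorem append (hs : IsIndPath G s u m) (ht : IsIndPath G t m v) (hst : MeetsOnlyAt G s t m) :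
    IsIndPath G (s ∪ t) u v := by
  induction hs with
  | single m =>
    rwa [Set.union_eq_self_of_subset_left (Set.singleton_subset_iff.2 ht.left_mem)]
  | @cons a b m s hab hs has hN ih =>
    have ham : a ≠ m := fun h => has (h ▸ hs.right_mem)
    have ha : ∀ y ∈ t, a = y ∨ G.Adj a y → y = m := fun y hy h =>
      (hst a (.inl rfl) y hy h).resolve_left ham
    rw [Set.insert_union]
    refine .cons hab (ih ht (hst.mono (Set.subset_insert a s) subset_rfl)) ?_ ?_
    · rintro (h | h)
      · exact has h
      · exact ham (ha a h (.inl rfl))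
    · rintro x (h | h) hx
      · exact hN x h hx
      · obtain rfl := ha x h (.inr hx)
        exact hN x hs.right_mem hx

theorem pair (h : G.Adj u v) : IsIndPath G {u, v} u v :=
  .cons h (.single v) h.ne fun _ hx _ => hx

theorem join (hs : IsIndPath G s u m) (ht : IsIndPath G t n v) (hmn : G.Adj m n)
    (hst : JoinedOnlyBy G s t m n) : IsIndPath G (s ∪ t) u v := by
  have hm : IsIndPath G (insert m t) m v :=
    .cons hmn ht (fun h => (hst m hs.right_mem m h).1 rfl)
      fun x hx h => ((hst m hs.right_mem x hx).2 h).2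
  have h := hs.append hm fun x hx y hy hxy => by
    rcases hy with rfl | hy
    · exact .inr rfl
    · exact .inl ((hst x hx y hy).2 (hxy.resolve_left (hst x hx y hy).1)).1
  rwa [Set.union_insert, Set.insert_eq_of_mem (Set.mem_union_left t hs.right_mem)] at h

theorem symm (h : IsIndPath G s u v) : IsIndPath G s v u := by
  induction h with
  | single v => exact .single v
  | @cons a b v s hab hs has hN ih =>
    rw [Set.insert_eq, Set.union_comm]
    refine ih.join (.single a) hab.symm ?_
    rintro x hx _ rfl
    exact ⟨fun h => has (h ▸ hx), fun h => ⟨hN x hx h.symm, rfl⟩⟩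

theorem split (h : IsIndPath G s u v) (hm : m ∈ s) :
    ∃ s₁ s₂, IsIndPath G s₁ u m ∧ IsIndPath G s₂ m v ∧ s = s₁ ∪ s₂ ∧ MeetsOnlyAt G s₁ s₂ m := by
  induction h with
  | single v =>
    obtain rfl : m = v := hm
    exact ⟨{m}, {m}, .single m, .single m, (Set.union_self _).symm, fun x hx _ _ _ => .inl hx⟩
  | @cons a b v s hab hs has hN ih =>
    rcases hm with rfl | hm
    · exact ⟨{m}, _, .single m, .cons hab hs has hN, by simp, fun x hx _ _ _ => .inl hx⟩
    · obtain ⟨s₁, s₂, h₁, h₂, rfl, h₁₂⟩ := ih hm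
      refine ⟨insert a s₁, s₂, .cons hab h₁ (fun h => has (.inl h)) (fun x hx => hN x (.inl hx)),
        h₂, (Set.insert_union).symm, ?_⟩
      rintro x (rfl | hx) y hy hxy
      · rcases hxy with rfl | hxy
        · exact absurd (.inr hy) has
        · obtain rfl := hN y (.inr hy) hxy
          exact .inr (h₁₂.eq_of_mem h₁.left_mem hy)
      · exact h₁₂ x hx y hy hxy

theorem split_pair (h : IsIndPath G s u v) (hb : b ∈ s) (hc : c ∈ s) (hbc : b ≠ c) :
    ∃ u' v' s₁ m s₂, s(u', v') = s(u, v) ∧ IsIndPath G s₁ u' b ∧ IsIndPath G m b c ∧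
      IsIndPath G s₂ c v' ∧ s = s₁ ∪ m ∪ s₂ ∧ MeetsOnlyAt G s₁ m b ∧ MeetsOnlyAt G m s₂ c ∧
      JoinedOnlyBy G s₁ s₂ b c := by
  have ordered : ∀ {u v s₁ s₂}, IsIndPath G s₁ u b → IsIndPath G s₂ b v → MeetsOnlyAt G s₁ s₂ b →
      c ∈ s₂ → ∃ m s₃, IsIndPath G m b c ∧ IsIndPath G s₃ c v ∧ s₁ ∪ s₂ = s₁ ∪ m ∪ s₃ ∧
        MeetsOnlyAt G s₁ m b ∧ MeetsOnlyAt G m s₃ c ∧ JoinedOnlyBy G s₁ s₃ b c := by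
    intro u v s₁ s₂ h₁ h₂ h₁₂ hc
    obtain ⟨m, s₃, hm, h₃, rfl, hm₃⟩ := h₂.split hc
    have hb₃ : b ∉ s₃ := fun hb => hbc (hm₃.eq_of_mem hm.left_mem hb)
    refine ⟨m, s₃, hm, h₃, (Set.union_assoc ..).symm, h₁₂.mono subset_rfl Set.subset_union_left,
      hm₃, fun x hx y hy => ?_⟩
    have hxy : x = y ∨ G.Adj x y → x = b := fun h =>
      (h₁₂ x hx y (.inr hy) h).resolve_right fun hyb => hb₃ (hyb ▸ hy)
    refine ⟨fun h => hb₃ (hxy (.inl h) ▸ h ▸ hy), fun h => ?_⟩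
    obtain rfl := hxy (.inr h)
    exact ⟨rfl, (hm₃ x hm.left_mem y hy (.inr h)).resolve_left hbc⟩
  obtain ⟨s₁, s₂, h₁, h₂, rfl, h₁₂⟩ := h.split hb
  rcases hc with hc | hc
  · obtain ⟨m, s₃, h⟩ := ordered h₂.symm h₁.symm h₁₂.symm hc
    exact ⟨v, u, s₂, m, s₃, Sym2.eq_swap, h₂.symm, h.1, h.2.1, (Set.union_comm ..).trans h.2.2.1,
      h.2.2.2⟩
  · obtain ⟨m, s₃, h⟩ := ordered h₁ h₂ h₁₂ hc
    exact ⟨u, v, s₁, m, s₃, rfl, h₁, h⟩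

theorem connected (h : IsIndPath G s u v) : (G.induce s).Connected := by
  induction h with
  | single v => exact .of_subsingleton
  | @cons a b v s hab hs _ _ ih =>
    exact connected_induce_union (s := {a}) .of_subsingleton ih.preconnected rfl hs.left_mem hab

theorem map {W : Type*} {H : SimpleGraph W} (f : H ↪g G) {t : Set W} {u v : W}
    (h : IsIndPath H t u v) : IsIndPath G (f '' t) (f u) (f v) := by
  induction h with
  | single v => rw [Set.image_singleton]; exact .single (f v)
  | @cons a b v t hab ht hat hN ih =>
    rw [Set.image_insert_eq]
    refine .cons (f.map_adj_iff.2 hab) ih (by simpa using hat) ?_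
    rintro _ ⟨x, hx, rfl⟩ h
    rw [hN x hx (f.map_adj_iff.1 h)]

theorem exists_isPath {S : Set V} (h : IsIndPath G s u v) (hs : s ⊆ S) :
    ∃ w : (G.induce S).Walk ⟨u, hs h.left_mem⟩ ⟨v, hs h.right_mem⟩, w.IsPath ∧
      (∀ x : S, x ∈ w.support ↔ x.1 ∈ s) ∧
      ∀ x y : S, x.1 ∈ s → y.1 ∈ s → G.Adj x y → s(x, y) ∈ w.edges := by
  induction h with
  | single v => exact ⟨.nil, by simp, by simp [Subtype.ext_iff], by simp +contextual⟩
  | @cons a b v s hab h has hN ih =>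
    obtain ⟨w, hw, hsupp, hedges⟩ := ih fun x hx => hs (.inr hx)
    let ha : (G.induce S).Adj ⟨a, hs (.inl rfl)⟩ ⟨b, hs (.inr h.left_mem)⟩ := hab
    refine ⟨.cons ha w, by simp [hw, hsupp, has], by simp [hsupp, Subtype.ext_iff], ?_⟩
    rintro ⟨x, hxS⟩ ⟨y, hyS⟩ (rfl | hx) (rfl | hy) hxy
    · exact absurd hxy (G.loopless.irrefl _)
    · obtain rfl := hN y hy hxy
      simp
    · obtain rfl := hN x hx hxy.symm
      simp [Sym2.eq_swap]
    · exact List.mem_cons_of_mem _ (hedges _ _ hx hy hxy)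

end IsIndPath

variable {α : Type*} {H : SimpleGraph α}

/-- The union of the sets that `P` assigns to the edges of `H`. -/
def pathVerts (H : SimpleGraph α) (P : α → α → Set V) : Set V :=
  {x | ∃ i j, H.Adj i j ∧ x ∈ P i j}

/-- The induced paths `P i j`, one for each edge `ij` of `H`, together form an induced subgraph of
`G` that is a subdivision of `H` with branch vertices `b i`. The value of `P` is irrelevant at pairs
that are not edges of `H`, up to symmetry. -/
structure IsIndSubdivision (H : SimpleGraph α) (G : SimpleGraph V) (b : α → V)
    (P : α → α → Set V) : Prop where
  injective : b.Injective
  symm : ∀ i j, P i j = P j i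
  isIndPath : ∀ {i j}, H.Adj i j → IsIndPath G (P i j) (b i) (b j)
  eq_or_eq : ∀ {i j k}, H.Adj i j → b k ∈ P i j → k = i ∨ k = j
  mem_range : ∀ {i j k l x}, H.Adj i j → H.Adj k l → s(i, j) ≠ s(k, l) → x ∈ P i j → x ∈ P k l →
    x ∈ Set.range b
  exists_mem : ∀ {x y}, x ∈ pathVerts H P → y ∈ pathVerts H P → G.Adj x y →
    ∃ i j, H.Adj i j ∧ x ∈ P i j ∧ y ∈ P i j

theorem exists_walk_forall_adj {W : Type*} {K : SimpleGraph W} {b : α → W}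
    {p : ∀ i j, K.Walk (b i) (b j) → Prop} (hp : ∀ i j w, p i j w → p j i w.reverse)
    (h : ∀ i j, H.Adj i j → ∃ w, p i j w) :
    ∃ w : ∀ {i j}, H.Adj i j → K.Walk (b i) (b j),
      (∀ {i j} (hij : H.Adj i j), w hij.symm = (w hij).reverse) ∧
        ∀ {i j} (hij : H.Adj i j), p i j (w hij) := by
  classical
  obtain ⟨_, -⟩ := exists_wellFoundedLT α
  choose w hw using h
  refine ⟨fun {i j} hij => if i < j then w i j hij else (w j i hij.symm).reverse,
    fun {i j} hij => ?_, fun {i j} hij => ?_⟩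
  · rcases hij.ne.lt_or_gt with hlt | hlt <;> simp [hlt, hlt.not_gt]
  · dsimp only
    split_ifs
    · exact hw i j hij
    · exact hp j i _ (hw j i hij.symm)

namespace IsIndSubdivision

variable {b : α → V} {P : α → α → Set V}

theorem map {W : Type*} {G' : SimpleGraph W} (f : G ↪g G') (h : IsIndSubdivision H G b P) :
    IsIndSubdivision H G' (f ∘ b) fun i j => f '' P i j where
  injective := f.injective.comp h.injective
  symm i j := by rw [h.symm]
  isIndPath hij := (h.isIndPath hij).map f
  eq_or_eq hij hk := h.eq_or_eq hij (f.injective.mem_set_image.1 hk)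
  mem_range := by
    rintro i j k l _ hij hkl hne ⟨x, hx, rfl⟩ hx'
    obtain ⟨m, rfl⟩ := h.mem_range hij hkl hne hx (f.injective.mem_set_image.1 hx')
    exact ⟨m, rfl⟩
  exists_mem := by
    rintro _ _ ⟨i, j, hij, x, hx, rfl⟩ ⟨k, l, hkl, y, hy, rfl⟩ hxy
    obtain ⟨i', j', hij', hx', hy'⟩ :=
      h.exists_mem ⟨i, j, hij, hx⟩ ⟨k, l, hkl, hy⟩ (f.map_adj_iff.1 hxy)
    exact ⟨i', j', hij', Set.mem_image_of_mem f hx', Set.mem_image_of_mem f hy'⟩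

theorem isSubdivision (h : IsIndSubdivision H G b P) (hH : ∀ i, ∃ j, H.Adj i j) :
    IsSubdivision H (G.induce (pathVerts H P)) := by
  have hP : ∀ {i j}, H.Adj i j → P i j ⊆ pathVerts H P := fun {i j} hij x hx => ⟨i, j, hij, hx⟩
  have hb : ∀ i, b i ∈ pathVerts H P := fun i =>
    have ⟨_, hij⟩ := hH i
    hP hij (h.isIndPath hij).left_mem
  obtain ⟨w, w_symm, hw⟩ := exists_walk_forall_adj (H := H) (K := G.induce (pathVerts H P))
    (b := fun i => ⟨b i, hb i⟩)
    (p := fun i j w => w.IsPath ∧ (∀ x, x ∈ w.support ↔ x.1 ∈ P i j) ∧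
      ∀ x y : pathVerts H P, x.1 ∈ P i j → y.1 ∈ P i j → G.Adj x y → s(x, y) ∈ w.edges)
    (fun i j w hw => by simpa [h.symm j i] using hw)
    (fun i j hij => (h.isIndPath hij).exists_isPath (hP hij))
  refine ⟨⟨fun i => ⟨b i, hb i⟩, fun i j hij => h.injective (congrArg Subtype.val hij), w,
    fun hij => (hw hij).1, w_symm, fun hij k hk => h.eq_or_eq hij ((hw hij).2.1 _ |>.1 hk),
    ?_, ?_, ?_⟩⟩
  · intro i j k l hij hkl hne x hx hx'
    obtain ⟨m, hm⟩ := h.mem_range hij hkl hne (((hw hij).2.1 x).1 hx) (((hw hkl).2.1 x).1 hx')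
    exact ⟨m, Subtype.ext hm⟩
  · rintro ⟨x, i, j, hij, hx⟩
    exact .inr ⟨i, j, hij, ((hw hij).2.1 _).2 hx⟩
  · refine Sym2.ind fun x y (hxy : G.Adj x y) => ?_
    obtain ⟨i, j, hij, hx, hy⟩ := h.exists_mem x.2 y.2 hxy
    exact ⟨i, j, hij, (hw hij).2.2 x y hx hy hxy⟩

end IsIndSubdivision

/-- Some induced subgraph of `G` is a subdivision of the complete graph on four vertices. -/
def HasISK4 (G : SimpleGraph V) : Prop :=
  ∃ b P, IsIndSubdivision (⊤ : SimpleGraph (Fin 4)) G b P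

theorem HasISK4.not_isk4Free (h : HasISK4 G) : ¬ G.ISK4Free := by
  obtain ⟨b, P, h⟩ := h
  exact fun hfree => hfree _ (h.isSubdivision fun i => exists_ne i |>.imp fun _ => Ne.symm)

theorem HasISK4.of_induce {S : Set V} (h : HasISK4 (G.induce S)) : HasISK4 G := by
  obtain ⟨b, P, h⟩ := h
  exact ⟨_, _, h.map (Embedding.induce S)⟩

section Cone

variable {n : ℕ} {b : Fin n → V} {P : Fin n → Fin n → Set V} {L : Fin n → Set V} {o : V}

/-- The paths of a cone: the legs `L i` lead from the apex, which gets the index `0`, to the former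
branch vertices, and the paths `P i j` are kept. -/
def conePaths (L : Fin n → Set V) (P : Fin n → Fin n → Set V) : Fin (n + 1) → Fin (n + 1) → Set V :=
  Fin.cons (Fin.cons ∅ L) fun i => Fin.cons (L i) (P i)

theorem conePaths_cases {i j : Fin (n + 1)} (hij : i ≠ j) :
    (∃ k, s(i, j) = s(0, k.succ) ∧ conePaths L P i j = L k) ∨
      ∃ k l, k ≠ l ∧ s(i, j) = s(k.succ, l.succ) ∧ conePaths L P i j = P k l := by
  induction i using Fin.cases with
  | zero =>
    induction j using Fin.cases with
    | zero => exact absurd rfl hij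
    | succ l => exact .inl ⟨l, rfl, rfl⟩
  | succ k =>
    induction j using Fin.cases with
    | zero => exact .inl ⟨k, Sym2.eq_swap, rfl⟩
    | succ l => exact .inr ⟨k, l, fun h => hij (congrArg Fin.succ h), rfl, rfl⟩

theorem mem_pathVerts_conePaths {x : V} (hx : x ∈ pathVerts ⊤ (conePaths L P)) :
    (∃ k, x ∈ L k) ∨ x ∈ pathVerts ⊤ P := by
  obtain ⟨i, j, hij, hx⟩ := hx
  rcases conePaths_cases (L := L) (P := P) hij with ⟨k, -, h⟩ | ⟨k, l, hkl, -, h⟩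
  · exact .inl ⟨k, h ▸ hx⟩
  · exact .inr ⟨k, l, hkl, h ▸ hx⟩

theorem IsIndSubdivision.branch_mem (h : IsIndSubdivision (⊤ : SimpleGraph (Fin n)) G b P) {x : V}
    (hx : x ∈ pathVerts ⊤ P) (i : Fin n) : b i ∈ pathVerts ⊤ P := by
  obtain ⟨k, l, hkl, -⟩ := hx
  by_cases hik : i = k
  · subst hik
    exact ⟨i, l, hkl, (h.isIndPath hkl).left_mem⟩
  · exact ⟨i, k, hik, (h.isIndPath hik).left_mem⟩

/-- The induced paths `L i` from the apex `o` to the branch vertices of an induced subdivision of a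
complete graph extend it to one of the complete graph with one more vertex. -/
structure IsCone (G : SimpleGraph V) (b : Fin n → V) (P : Fin n → Fin n → Set V) (o : V)
    (L : Fin n → Set V) : Prop where
  base : IsIndSubdivision (⊤ : SimpleGraph (Fin n)) G b P
  isIndPath : ∀ i, IsIndPath G (L i) o (b i)
  apex_ne : ∀ i, o ≠ b i
  legs : ∀ {i j x y}, i ≠ j → x ∈ L i → y ∈ L j → x = y ∨ G.Adj x y →
    x = o ∨ y = o ∨ x = b i ∧ y = b j
  leg_base : ∀ {i x y}, x ∈ L i → y ∈ pathVerts ⊤ P → x = y ∨ G.Adj x y →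
    x = b i ∨ y = b i ∨ x = o ∧ ∃ l, y = b l

namespace IsCone

theorem eq_apex (h : IsCone G b P o L) {i j : Fin n} {x : V} (hij : i ≠ j) (hi : x ∈ L i)
    (hj : x ∈ L j) : x = o := by
  rcases h.legs hij hi hj (.inl rfl) with h' | h' | ⟨hi', hj'⟩
  exacts [h', h', absurd (h.base.injective (hi'.symm.trans hj')) hij]

theorem eq_branch (h : IsCone G b P o L) {i : Fin n} {x : V} (hi : x ∈ L i)
    (hx : x ∈ pathVerts ⊤ P) : x = b i := by
  rcases h.leg_base hi hx (.inl rfl) with h' | h' | ⟨ho, l, hl⟩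
  exacts [h', h', absurd (ho.symm.trans hl) (h.apex_ne l)]

theorem eq_or_eq (h : IsCone G b P o L) {i j k : Fin (n + 1)} (hij : i ≠ j)
    (hk : Fin.cons (α := fun _ => V) o b k ∈ conePaths L P i j) : k = i ∨ k = j := by
  rw [← Sym2.mem_iff]
  rcases conePaths_cases (L := L) (P := P) hij with ⟨l, he, hl⟩ | ⟨l, m, hlm, he, hl⟩ <;>
    rw [he] <;> rw [hl] at hk <;> cases k using Fin.cases with | zero => _ | succ k => _
  · exact Sym2.mem_mk_left _ _
  · by_cases hkl : k = l
    · exact hkl ▸ Sym2.mem_mk_right _ _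
    · exact absurd (h.eq_apex hkl (h.isIndPath k).right_mem hk).symm (h.apex_ne k)
  · exact absurd (h.eq_branch (h.isIndPath l).left_mem ⟨l, m, hlm, hk⟩) (h.apex_ne l)
  · exact Sym2.mem_iff.2 ((h.base.eq_or_eq hlm hk).imp (congrArg Fin.succ) (congrArg Fin.succ))

theorem mem_range (h : IsCone G b P o L) {i j i' j' : Fin (n + 1)} {x : V} (hij : i ≠ j)
    (hij' : i' ≠ j') (hne : s(i, j) ≠ s(i', j')) (hx : x ∈ conePaths L P i j)
    (hx' : x ∈ conePaths L P i' j') : x = o ∨ x ∈ Set.range b := by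
  rcases conePaths_cases (L := L) (P := P) hij with ⟨k, he, hk⟩ | ⟨k, l, hkl, he, hk⟩ <;>
    rcases conePaths_cases (L := L) (P := P) hij' with ⟨k', he', hk'⟩ | ⟨k', l', hkl', he', hk'⟩ <;>
    rw [he, he'] at hne <;> rw [hk] at hx <;> rw [hk'] at hx'
  · have hkk' : k ≠ k' := fun e => hne (by rw [e])
    exact .inl (h.eq_apex hkk' hx hx')
  · exact .inr ⟨k, (h.eq_branch hx ⟨k', l', hkl', hx'⟩).symm⟩
  · exact .inr ⟨k', (h.eq_branch hx' ⟨k, l, hkl, hx⟩).symm⟩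
  · exact .inr (h.base.mem_range hkl hkl' (fun e => hne (congrArg (Sym2.map Fin.succ) e)) hx hx')

theorem exists_mem (h : IsCone G b P o L) {x y : V} (hx : x ∈ pathVerts ⊤ (conePaths L P))
    (hy : y ∈ pathVerts ⊤ (conePaths L P)) (hxy : G.Adj x y) :
    ∃ i j, i ≠ j ∧ x ∈ conePaths L P i j ∧ y ∈ conePaths L P i j := by
  have leg : ∀ {x y} k, x ∈ L k → y ∈ L k →
      ∃ i j, i ≠ j ∧ x ∈ conePaths L P i j ∧ y ∈ conePaths L P i j :=
    fun k hx hy => ⟨0, k.succ, (Fin.succ_ne_zero k).symm, hx, hy⟩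
  have base : ∀ {x y}, x ∈ pathVerts ⊤ P → y ∈ pathVerts ⊤ P → G.Adj x y →
      ∃ i j, i ≠ j ∧ x ∈ conePaths L P i j ∧ y ∈ conePaths L P i j := fun hx hy hxy => by
    obtain ⟨k, l, hkl, hx, hy⟩ := h.base.exists_mem hx hy hxy
    exact ⟨k.succ, l.succ, fun e => hkl (Fin.succ_injective n e), hx, hy⟩
  have leg_base : ∀ {k x y}, x ∈ L k → y ∈ pathVerts ⊤ P → G.Adj x y →
      ∃ i j, i ≠ j ∧ x ∈ conePaths L P i j ∧ y ∈ conePaths L P i j := fun {k _ _} hx hy hxy => by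
    rcases h.leg_base hx hy (.inr hxy) with rfl | rfl | ⟨rfl, l, rfl⟩
    · exact base (h.base.branch_mem hy k) hy hxy
    · exact leg k hx (h.isIndPath k).right_mem
    · exact leg l (h.isIndPath l).left_mem (h.isIndPath l).right_mem
  rcases mem_pathVerts_conePaths hx with ⟨k, hx⟩ | hx <;>
    rcases mem_pathVerts_conePaths hy with ⟨l, hy⟩ | hy
  · by_cases hkl : k = l
    · exact leg l (hkl ▸ hx) hy
    rcases h.legs hkl hx hy (.inr hxy) with rfl | rfl | ⟨rfl, rfl⟩
    · exact leg l (h.isIndPath l).left_mem hy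
    · exact leg k hx (h.isIndPath k).left_mem
    · have hP := h.base.isIndPath hkl
      exact base ⟨k, l, hkl, hP.left_mem⟩ ⟨k, l, hkl, hP.right_mem⟩ hxy
  · exact leg_base hx hy hxy
  · exact (leg_base hy hx hxy.symm).imp fun i => Exists.imp fun j => And.imp_right And.symm
  · exact base hx hy hxy

theorem isIndSubdivision (h : IsCone G b P o L) :
    IsIndSubdivision (⊤ : SimpleGraph (Fin (n + 1))) G (Fin.cons o b) (conePaths L P) where
  injective := Fin.cons_injective_iff.2 ⟨fun ⟨i, hi⟩ => h.apex_ne i hi.symm, h.base.injective⟩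
  symm := Fin.cases (Fin.cases rfl fun j => rfl) fun i => Fin.cases rfl fun j => h.base.symm i j
  isIndPath {i j} hij := by
    cases i using Fin.cases <;> cases j using Fin.cases
    exacts [absurd rfl hij, h.isIndPath _, (h.isIndPath _).symm,
      h.base.isIndPath fun e => hij (congrArg Fin.succ e)]
  eq_or_eq := h.eq_or_eq
  mem_range hij hij' hne hx hx' := by
    rw [Fin.range_cons]
    exact h.mem_range hij hij' hne hx hx'
  exists_mem := h.exists_mem

end IsCone

end Cone

theorem not_adj_of_common_adj (htri : G.CliqueFree 3) {a b c : V} (hab : G.Adj a b)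
    (hac : G.Adj a c) : ¬ G.Adj b c := fun hbc => by
  classical
  exact htri {a, b, c} (is3Clique_triple_iff.2 ⟨hab, hac, hbc⟩)

theorem dist_le_dist_add_one (hG : G.Connected) {u x : V} (hux : G.Adj u x) (v : V) :
    G.dist u v ≤ G.dist x v + 1 := by
  have := hG.dist_triangle (u := u) (v := x) (w := v)
  rwa [dist_eq_one_iff_adj.2 hux, add_comm] at this

theorem exists_isIndPath_dist (hG : G.Connected) (u v : V) :
    ∃ s, IsIndPath G s u v ∧ ∀ x ∈ s, G.dist u x + G.dist x v = G.dist u v := by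
  induction hd : G.dist u v generalizing u with
  | zero =>
    obtain rfl := hG.dist_eq_zero_iff.1 hd
    exact ⟨{u}, .single u, by simp⟩
  | succ d ih =>
    obtain ⟨w, hw⟩ := hG.exists_walk_length_eq_dist u v
    cases w with
    | nil => simp at hd
    | @cons _ m _ hum w =>
      have hm : G.dist m v = d := by
        have := G.dist_le w
        have := dist_le_dist_add_one hG hum v
        rw [Walk.length_cons] at hw
        omega
      obtain ⟨s, hs, hsd⟩ := ih m hm
      refine ⟨insert u s, .cons hum hs ?_ ?_, ?_⟩
      · intro hus
        have := hsd u hus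
        omega
      · intro x hx hux
        have := hsd x hx
        have := dist_le_dist_add_one hG hux v
        exact (hG.dist_eq_zero_iff.1 (by omega : G.dist m x = 0)).symm
      · rintro x (rfl | hx)
        · simp [hd]
        · have := hsd x hx
          have := dist_le_dist_add_one hG hum x
          have := hG.dist_triangle (u := u) (v := x) (w := v)
          omega

theorem exists_isIndPath_subset {T : Set V} (hT : (G.induce T).Preconnected) {u v : V}
    (hu : u ∈ T) (hv : v ∈ T) : ∃ s ⊆ T, IsIndPath G s u v := by
  have : Nonempty T := ⟨⟨u, hu⟩⟩
  obtain ⟨s, hs, -⟩ := exists_isIndPath_dist (Connected.mk hT) ⟨u, hu⟩ ⟨v, hv⟩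
  exact ⟨_, Subtype.coe_image_subset T s, hs.map (Embedding.induce T)⟩

/- The apex `o` is a median of the three vertices. Comparing it with a vertex `x` of one leg shows
that no vertex `y` of another leg is closer to `x` than to `o`. -/
theorem exists_claw (hG : G.Connected) (htri : G.CliqueFree 3) (t : Fin 3 → V) :
    ∃ o, ∃ Q : Fin 3 → Set V, (∀ i, IsIndPath G (Q i) o (t i)) ∧
      ∀ i j, i ≠ j → MeetsOnlyAt G (Q i) (Q j) o := by
  have := hG.nonempty
  let o := Function.argmin fun o => ∑ i, G.dist o (t i)
  choose Q hQ hQd using fun i => exists_isIndPath_dist hG o (t i)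
  have dist_le : ∀ i j, i ≠ j → ∀ x ∈ Q i, ∀ y ∈ Q j, G.dist o y ≤ G.dist x y := by
    intro i j hij x hx y hy
    obtain ⟨k, hik, hjk⟩ : ∃ k, i ≠ k ∧ j ≠ k := by clear hx hy; decide +revert
    have huniv : Finset.univ = {i, j, k} := by clear hx hy; decide +revert
    have hmin : ∑ i, G.dist o (t i) ≤ ∑ i, G.dist x (t i) :=
      Function.argmin_le (fun o => ∑ i, G.dist o (t i)) x
    rw [huniv, Finset.sum_insert (by simp [hij, hik]), Finset.sum_insert (by simp [hjk]),
      Finset.sum_singleton, Finset.sum_insert (by simp [hij, hik]),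
      Finset.sum_insert (by simp [hjk]), Finset.sum_singleton] at hmin
    have := hQd i x hx
    have := hQd j y hy
    have := hG.dist_triangle (u := x) (v := y) (w := t j)
    have := hG.dist_triangle (u := x) (v := o) (w := t k)
    rw [G.dist_comm (u := x) (v := o)] at this
    omega
  refine ⟨o, Q, hQ, fun i j hij x hx y hy hxy => ?_⟩
  have hy' := dist_le i j hij x hx y hy
  rcases hxy with rfl | hxy
  · rw [dist_self, Nat.le_zero, hG.dist_eq_zero_iff] at hy'
    exact .inl hy'.symm
  · have hx' := dist_le j i hij.symm y hy x hx
    rw [dist_eq_one_iff_adj.2 hxy] at hy'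
    rw [dist_eq_one_iff_adj.2 hxy.symm] at hx'
    by_contra! hne
    have adj : ∀ {z}, z ≠ o → G.dist o z ≤ 1 → G.Adj o z := fun hz h =>
      dist_eq_one_iff_adj.1 (le_antisymm h (hG.pos_dist_of_ne hz.symm))
    exact not_adj_of_common_adj htri (adj hne.1 hx') (adj hne.2 hy') hxy

theorem exists_claw_subset (htri : G.CliqueFree 3) {T : Set V} (hT : (G.induce T).Preconnected)
    {t : Fin 3 → V} (ht : ∀ i, t i ∈ T) :
    ∃ o ∈ T, ∃ Q : Fin 3 → Set V, (∀ i, Q i ⊆ T) ∧ (∀ i, IsIndPath G (Q i) o (t i)) ∧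
      ∀ i j, i ≠ j → MeetsOnlyAt G (Q i) (Q j) o := by
  have : Nonempty T := ⟨⟨t 0, ht 0⟩⟩
  obtain ⟨o, Q, hQ, hQQ⟩ := exists_claw (Connected.mk hT) (htri.comap ⟨Copy.induce G T⟩)
    fun i => ⟨t i, ht i⟩
  refine ⟨o, o.2, fun i => Subtype.val '' Q i, fun i => Subtype.coe_image_subset T (Q i),
    fun i => (hQ i).map (Embedding.induce T), ?_⟩
  rintro i j hij _ ⟨x, hx, rfl⟩ _ ⟨y, hy, rfl⟩ hxy
  exact (hQQ i j hij x hx y hy (hxy.imp_left Subtype.ext)).imp (congrArg _) (congrArg _)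

theorem IsIndSubdivision.hasISK4 (htri : G.CliqueFree 3) {b : Fin 3 → V}
    {P : Fin 3 → Fin 3 → Set V} (h : IsIndSubdivision (⊤ : SimpleGraph (Fin 3)) G b P) {T : Set V}
    (hT : (G.induce T).Preconnected) (hPT : Disjoint (pathVerts ⊤ P) T) {t : Fin 3 → V}
    (ht : ∀ i, t i ∈ T) (hbt : ∀ i, G.Adj (b i) (t i))
    (hadj : ∀ x ∈ pathVerts ⊤ P, ∀ y ∈ T, G.Adj x y → ∃ i, x = b i ∧ y = t i) : HasISK4 G := by
  obtain ⟨o, ho, Q, hQT, hQ, hQQ⟩ := exists_claw_subset htri hT ht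
  have hbP : ∀ i, b i ∈ pathVerts ⊤ P := h.branch_mem
    ⟨0, 1, Fin.zero_ne_one, (h.isIndPath Fin.zero_ne_one).left_mem⟩
  have hP : ∀ {x y}, x ∈ pathVerts ⊤ P → y ∈ T → x ≠ y := fun hx hy e =>
    Set.disjoint_left.1 hPT hx (e ▸ hy)
  have hbadj : ∀ {i y}, y ∈ T → G.Adj (b i) y → y = t i := fun {i y} hy hiy => by
    obtain ⟨j, hj, rfl⟩ := hadj _ (hbP i) y hy hiy
    rw [h.injective hj]
  have legs_at : ∀ {i j y}, i ≠ j → y ∈ Q j → b i = y ∨ G.Adj (b i) y → y = o :=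
    fun {i j y} hij hy hiy => by
      obtain rfl := hbadj (hQT j hy) (hiy.resolve_left (hP (hbP i) (hQT j hy)))
      exact (hQQ i j hij).eq_of_mem (hQ i).right_mem hy
  have cone : IsCone G b P o fun i => insert (b i) (Q i) := by
    refine ⟨h, fun i => .symm (.cons (hbt i) (hQ i).symm (fun hi => hP (hbP i) (hQT i hi) rfl)
      fun x hx => hbadj (hQT i hx)), fun i => (hP (hbP i) ho).symm, ?_, ?_⟩
    · rintro i j x y hij (rfl | hx) (rfl | hy) hxy
      · exact .inr (.inr ⟨rfl, rfl⟩)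
      · exact .inr (.inl (legs_at hij hy hxy))
      · exact .inl (legs_at hij.symm hx (hxy.imp Eq.symm Adj.symm))
      · exact or_assoc.1 (.inl (hQQ i j hij x hx y hy hxy))
    · rintro i x y (rfl | hx) hy hxy
      · exact .inl rfl
      · obtain ⟨k, rfl, rfl⟩ :=
          hadj y hy x (hQT i hx) (hxy.resolve_left (hP hy (hQT i hx)).symm).symm
        by_cases hki : k = i
        · exact .inr (.inl (hki ▸ rfl))
        · exact .inr (.inr ⟨(hQQ k i hki).eq_of_mem (hQ k).right_mem hx, k, rfl⟩)
  exact ⟨_, _, cone.isIndSubdivision⟩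

theorem IsIndPath.isIndSubdivision {s : Set V} {u v : V} (h : IsIndPath G s u v) (huv : u ≠ v) :
    IsIndSubdivision (⊤ : SimpleGraph (Fin 2)) G ![u, v] fun _ _ => s where
  injective := by simp [Function.Injective, Fin.forall_fin_two, huv, huv.symm]
  symm _ _ := rfl
  isIndPath {i j} hij := by
    fin_cases i <;> fin_cases j
    exacts [absurd rfl hij, h, h.symm, absurd rfl hij]
  eq_or_eq {i j k} hij _ := by
    rw [top_adj] at hij
    omega
  mem_range {i j k l _} hij hkl hne := by
    rw [top_adj] at hij hkl
    exact absurd (by decide +revert) hne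
  exists_mem := by
    rintro x y ⟨i, j, hij, hx⟩ ⟨_, _, _, hy⟩ -
    exact ⟨i, j, hij, hx, hy⟩

theorem IsIndPath.isCone {a b c : V} {m l₁ l₂ : Set V} (hm : IsIndPath G m b c) (hbc : b ≠ c)
    (h₁ : IsIndPath G l₁ a b) (h₂ : IsIndPath G l₂ a c) (hab : a ≠ b) (hac : a ≠ c)
    (h₁₂ : ∀ x ∈ l₁, ∀ y ∈ l₂, x = y ∨ G.Adj x y → x = a ∨ y = a ∨ x = b ∧ y = c)
    (h₁m : ∀ x ∈ l₁, ∀ y ∈ m, x = y ∨ G.Adj x y → x = b ∨ y = b ∨ x = a ∧ y = c)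
    (h₂m : ∀ x ∈ l₂, ∀ y ∈ m, x = y ∨ G.Adj x y → x = c ∨ y = c ∨ x = a ∧ y = b) :
    IsCone G ![b, c] (fun _ _ => m) a ![l₁, l₂] where
  base := hm.isIndSubdivision hbc
  isIndPath := Fin.forall_fin_two.2 ⟨h₁, h₂⟩
  apex_ne := Fin.forall_fin_two.2 ⟨hab, hac⟩
  legs {i j x y} hij hx hy hxy := by
    fin_cases i <;> fin_cases j
    · exact absurd rfl hij
    · exact h₁₂ x hx y hy hxy
    · have := h₁₂ y hy x hx (hxy.imp Eq.symm Adj.symm)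
      exact or_left_comm.1 (this.imp_right (Or.imp_right And.symm))
    · exact absurd rfl hij
  leg_base {i x y} hx hy hxy := by
    obtain ⟨_, _, _, hy⟩ := hy
    fin_cases i
    · exact (h₁m x hx y hy hxy).imp_right (Or.imp_right (And.imp_right fun h => ⟨1, h⟩))
    · exact (h₂m x hx y hy hxy).imp_right (Or.imp_right (And.imp_right fun h => ⟨0, h⟩))

/-- The induced path `s` from `u` to `v` is closed to an induced cycle by the vertex `a`. -/
structure IsIndCycle (G : SimpleGraph V) (a : V) (s : Set V) (u v : V) : Prop where
  isIndPath : IsIndPath G s u v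
  notMem : a ∉ s
  adj_iff : ∀ x ∈ s, G.Adj a x ↔ x = u ∨ x = v

namespace IsIndCycle

variable {a b c u v : V} {s : Set V}

theorem exists_arcs (h : IsIndCycle G a s u v) (hb : b ∈ s) (hc : c ∈ s) (hbc : b ≠ c) :
    ∃ s₁ m s₂, IsIndPath G (insert a s₁) a b ∧ IsIndPath G m b c ∧ IsIndPath G (insert a s₂) a c ∧
      s = s₁ ∪ m ∪ s₂ ∧ MeetsOnlyAt G s₁ m b ∧ MeetsOnlyAt G m s₂ c ∧ JoinedOnlyBy G s₁ s₂ b c ∧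
      ∀ y ∈ m, G.Adj a y → y = b ∨ y = c := by
  obtain ⟨u', v', s₁, m, s₂, huv, h₁, hm, h₂, rfl, hm₁, hm₂, h₁₂⟩ :=
    h.isIndPath.split_pair hb hc hbc
  have adj_iff : ∀ x ∈ s₁ ∪ m ∪ s₂, G.Adj a x ↔ x = u' ∨ x = v' := fun x hx =>
    (h.adj_iff x hx).trans (by rw [← Sym2.mem_iff, ← Sym2.mem_iff, huv])
  refine ⟨s₁, m, s₂, ?_, hm, ?_, rfl, hm₁, hm₂, h₁₂, fun y hy hay => ?_⟩
  · exact .cons ((adj_iff _ (.inl (.inl h₁.left_mem))).2 (.inl rfl)) h₁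
      (fun ha => h.notMem (.inl (.inl ha))) fun x hx hax =>
        ((adj_iff x (.inl (.inl hx))).1 hax).resolve_right fun e => (h₁₂ x hx v' h₂.right_mem).1 e
  · exact .cons ((adj_iff _ (.inr h₂.right_mem)).2 (.inr rfl)) h₂.symm
      (fun ha => h.notMem (.inr ha)) fun x hx hax =>
        ((adj_iff x (.inr hx)).1 hax).resolve_left fun e => (h₁₂ u' h₁.left_mem x hx).1 e.symm
  · rcases (adj_iff y (.inl (.inr hy))).1 hay with rfl | rfl
    · exact .inl (hm₁.eq_of_mem h₁.left_mem hy)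
    · exact .inr (hm₂.eq_of_mem hy h₂.right_mem)

theorem exists_isIndSubdivision (h : IsIndCycle G a s u v) (hb : b ∈ s) (hc : c ∈ s)
    (hbc : b ≠ c) :
    ∃ P, IsIndSubdivision (⊤ : SimpleGraph (Fin 3)) G ![a, b, c] P ∧
      pathVerts ⊤ P ⊆ insert a s := by
  obtain ⟨s₁, m, s₂, h₁, hm, h₂, rfl, hm₁, hm₂, h₁₂, ham⟩ := h.exists_arcs hb hc hbc
  have ham : ∀ y ∈ m, a = y ∨ G.Adj a y → y = b ∨ y = c := fun y hy hay =>
    ham y hy (hay.resolve_left fun e => h.notMem (.inl (.inr (e ▸ hy))))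
  have cone : IsCone G ![b, c] (fun _ _ => m) a ![insert a s₁, insert a s₂] := by
    refine hm.isCone hbc h₁ h₂ (fun e => h.notMem (e ▸ hb)) (fun e => h.notMem (e ▸ hc)) ?_ ?_ ?_
    · rintro x (rfl | hx) y (rfl | hy) hxy
      · exact .inl rfl
      · exact .inl rfl
      · exact .inr (.inl rfl)
      · have h := h₁₂ x hx y hy
        exact .inr (.inr (h.2 (hxy.resolve_left h.1)))
    · rintro x (rfl | hx) y hy hxy
      · exact (ham y hy hxy).elim (fun h => .inr (.inl h)) fun h => .inr (.inr ⟨rfl, h⟩)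
      · exact or_assoc.1 (.inl (hm₁ x hx y hy hxy))
    · rintro x (rfl | hx) y hy hxy
      · exact (ham y hy hxy).elim (fun h => .inr (.inr ⟨rfl, h⟩)) fun h => .inr (.inl h)
      · exact or_assoc.1 (.inl (hm₂.symm x hx y hy hxy))
  refine ⟨_, cone.isIndSubdivision, fun x hx => ?_⟩
  rcases mem_pathVerts_conePaths hx with ⟨k, hx⟩ | ⟨_, _, _, hx⟩
  · fin_cases k
    · exact hx.imp_right fun hx => .inl (.inl hx)
    · exact hx.imp_right .inr
  · exact .inr (.inl (.inr hx))

theorem hasISK4 (htri : G.CliqueFree 3) (h : IsIndCycle G a s u v) (hb : b ∈ s) (hc : c ∈ s)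
    (hbc : b ≠ c) {T : Set V} (hT : (G.induce T).Preconnected) (hsT : Disjoint (insert a s) T)
    {ta tb tc : V} (hta : ta ∈ T) (htb : tb ∈ T) (htc : tc ∈ T) (hata : G.Adj a ta)
    (hbtb : G.Adj b tb) (hctc : G.Adj c tc)
    (hadj : ∀ x ∈ insert a s, ∀ y ∈ T, G.Adj x y →
      x = a ∧ y = ta ∨ x = b ∧ y = tb ∨ x = c ∧ y = tc) : HasISK4 G := by
  obtain ⟨P, hP, hPs⟩ := h.exists_isIndSubdivision hb hc hbc
  refine hP.hasISK4 htri hT (hsT.mono_left hPs) (t := ![ta, tb, tc])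
    (by simp [Fin.forall_fin_succ, *]) (by simp [Fin.forall_fin_succ, *]) ?_
  intro x hx y hy hxy
  simpa [Fin.exists_fin_succ] using hadj x (hPs hx) y hy hxy

end IsIndCycle

/-- The function `lay` behaves like the distance from a vertex of a connected graph. -/
structure IsLayering (G : SimpleGraph V) (lay : V → ℕ) : Prop where
  le_add_one : ∀ {x y}, G.Adj x y → lay x ≤ lay y + 1
  exists_parent : ∀ {v}, lay v ≠ 0 → ∃ w, G.Adj v w ∧ lay w + 1 = lay v
  root_unique : ∀ {x y}, lay x = 0 → lay y = 0 → x = y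

theorem isLayering_dist (hG : G.Connected) (u : V) : IsLayering G (G.dist u) where
  le_add_one {x y} hxy := by
    rw [G.dist_comm, G.dist_comm (u := u)]
    exact dist_le_dist_add_one hG hxy u
  exists_parent {v} hv := by
    obtain ⟨s, hs, hdist⟩ := exists_isIndPath_dist hG v u
    cases hs with
    | single => simp at hv
    | @cons _ w _ _ hvw hs _ _ =>
      have := hdist w (.inr hs.left_mem)
      rw [dist_eq_one_iff_adj.2 hvw, G.dist_comm (u := w), G.dist_comm (u := v)] at this
      exact ⟨w, hvw, by omega⟩
  root_unique hx hy := (hG.dist_eq_zero_iff.1 hx).symm.trans (hG.dist_eq_zero_iff.1 hy)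

theorem exists_preconnected_unique_adj {S s : Set V} {p : V} (hS : (G.induce S).Preconnected)
    (hpS : p ∈ S) (hs : (G.induce s).Connected) (hsS : s ⊆ S) (hps : p ∉ s)
    (hadj : ∀ x ∈ s, ¬ G.Adj p x) :
    ∃ T ⊆ S, (G.induce T).Preconnected ∧ s ⊆ T ∧ p ∉ T ∧
      ∃ t ∈ T, G.Adj p t ∧ ∀ y ∈ T, G.Adj p y → y = t := by
  obtain ⟨⟨q, hq⟩⟩ := hs.nonempty
  obtain ⟨m, hmS, hm⟩ := exists_isIndPath_subset hS hpS (hsS hq)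
  cases hm with
  | single => exact absurd hq hps
  | @cons _ t _ m hpt hm hpm hN =>
    refine ⟨s ∪ m, Set.union_subset hsS fun x hx => hmS (.inr hx),
      (induce_union_connected hs.preconnected hm.connected.preconnected
        ⟨q, hq, hm.right_mem⟩).preconnected,
      Set.subset_union_left, fun h => h.elim hps hpm, t, .inr hm.left_mem, hpt, ?_⟩
    rintro y (hy | hy) hpy
    · exact absurd hpy (hadj y hy)
    · exact hN y hy hpy

namespace IsLayering

variable {lay : V → ℕ}

theorem preconnected (hL : IsLayering G lay) {S : Set V}
    (hS : ∀ v ∈ S, lay v ≠ 0 → ∃ w ∈ S, G.Adj v w ∧ lay w < lay v) :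
    (G.induce S).Preconnected := by
  have reach : ∀ n, ∀ v : S, lay v = n → ∃ z : S, lay z = 0 ∧ (G.induce S).Reachable v z := by
    intro n
    induction n using Nat.strong_induction_on with
    | _ n ih =>
      intro v hv
      by_cases h0 : lay v = 0
      · exact ⟨v, h0, Reachable.refl _⟩
      · obtain ⟨w, hw, hvw, hlt⟩ := hS v v.2 h0
        obtain ⟨z, hz, hwz⟩ := ih _ (hv ▸ hlt) ⟨w, hw⟩ rfl
        exact ⟨z, hz, Adj.reachable (G := G.induce S) (v := ⟨w, hw⟩) hvw |>.trans hwz⟩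
  intro x y
  obtain ⟨z, hz, hxz⟩ := reach _ x rfl
  obtain ⟨z', hz', hyz⟩ := reach _ y rfl
  obtain rfl : z = z' := Subtype.ext (hL.root_unique hz hz')
  exact hxz.trans hyz.symm

theorem preconnected_of_le (hL : IsLayering G lay) {S : Set V} {j : ℕ}
    (hj : ∀ v, lay v < j → v ∈ S) (hS : ∀ v ∈ S, lay v ≤ j) : (G.induce S).Preconnected :=
  hL.preconnected fun v hv h0 => by
    obtain ⟨w, hvw, hw⟩ := hL.exists_parent h0
    have := hS v hv
    exact ⟨w, hj w (by omega), hvw, by omega⟩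

/- The path runs through parents of its ends and the layers `< j - 1`, and `p` is not adjacent to
both a vertex of layer `j` and its parent. -/
theorem exists_isIndPath_above (hL : IsLayering G lay) (htri : G.CliqueFree 3) {p q r : V} {j : ℕ}
    (hp : lay p = j) (hq : lay q = j) (hr : lay r = j) (hj : j ≠ 0) :
    ∃ s, IsIndPath G s q r ∧ (∀ x ∈ s, lay x < j ∨ x = q ∨ x = r) ∧
      ∃ t t', ∀ y ∈ s, G.Adj p y → y = t ∨ y = t' := by
  obtain ⟨q', hqq, hlq⟩ := hL.exists_parent (v := q) (by omega)
  obtain ⟨r', hrr, hlr⟩ := hL.exists_parent (v := r) (by omega)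
  let S : Set V := {x | lay x + 1 < j ∨ x = q' ∨ x = r' ∨ x = q ∨ x = r}
  have hS : (G.induce S).Preconnected := hL.preconnected fun v hv h0 => by
    obtain ⟨w, hvw, hlw⟩ := hL.exists_parent h0
    rcases hv with hv | rfl | rfl | rfl | rfl
    · exact ⟨w, .inl (by omega), hvw, by omega⟩
    · exact ⟨w, .inl (by omega), hvw, by omega⟩
    · exact ⟨w, .inl (by omega), hvw, by omega⟩
    · exact ⟨q', .inr (.inl rfl), hqq, by omega⟩
    · exact ⟨r', .inr (.inr (.inl rfl)), hrr, by omega⟩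
  obtain ⟨s, hsS, hs⟩ := exists_isIndPath_subset hS (u := q) (v := r) (by simp [S]) (by simp [S])
  refine ⟨s, hs, fun x hx => ?_, ?_⟩
  · rcases hsS hx with h | rfl | rfl | rfl | rfl
    exacts [.inl (by omega), .inl (by omega), .inl (by omega), .inr (.inl rfl), .inr (.inr rfl)]
  · have one : ∀ {v w}, G.Adj v w → ∃ t, ∀ y, y = w ∨ y = v → G.Adj p y → y = t := by
      intro v w hvw
      by_cases hpv : G.Adj p v
      · refine ⟨v, ?_⟩
        rintro y (rfl | rfl) hpy
        exacts [absurd hvw (not_adj_of_common_adj htri hpv hpy), rfl]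
      · refine ⟨w, ?_⟩
        rintro y (rfl | rfl) hpy
        exacts [rfl, absurd hpy hpv]
    obtain ⟨t, ht⟩ := one hqq
    obtain ⟨t', ht'⟩ := one hrr
    refine ⟨t, t', fun y hy hpy => ?_⟩
    rcases hsS hy with h | rfl | rfl | rfl | rfl
    · have := hL.le_add_one hpy
      omega
    exacts [.inl (ht _ (.inl rfl) hpy), .inr (ht' _ (.inl rfl) hpy),
      .inl (ht _ (.inr rfl) hpy), .inr (ht' _ (.inr rfl) hpy)]

theorem exists_confluence (hL : IsLayering G lay) (htri : G.CliqueFree 3) {p q r : V} {j : ℕ}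
    (hp : lay p = j) (hq : lay q = j) (hr : lay r = j) (hpq : p ≠ q) (hpr : p ≠ r) :
    (∃ T, (G.induce T).Preconnected ∧ q ∈ T ∧ r ∈ T ∧ (∀ x ∈ T, lay x < j ∨ x = q ∨ x = r) ∧
      ∃ t ∈ T, G.Adj p t ∧ ∀ y ∈ T, G.Adj p y → y = t) ∨
    ∃ s, IsIndPath G s q r ∧ (∀ x ∈ s, lay x < j ∨ x = q ∨ x = r) ∧
      ∃ t ∈ s, ∃ t' ∈ s, t ≠ t' ∧ ∀ y ∈ s, G.Adj p y ↔ y = t ∨ y = t' := by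
  have hj : j ≠ 0 := by
    rintro rfl
    exact hpq (hL.root_unique hp hq)
  obtain ⟨s, hs, hls, t, t', htt'⟩ := hL.exists_isIndPath_above htri hp hq hr hj
  have hps : p ∉ s := fun h => by
    rcases hls p h with h | h | h
    exacts [absurd hp h.ne, hpq h, hpr h]
  by_cases hex : ∃ x ∈ s, G.Adj p x
  · obtain ⟨x, hx, hpx⟩ := hex
    by_cases hall : ∀ y ∈ s, G.Adj p y → y = x
    · exact .inl ⟨s, hs.connected.preconnected, hs.left_mem, hs.right_mem, hls, x, hx, hpx, hall⟩
    · push Not at hall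
      obtain ⟨y, hy, hpy, hyx⟩ := hall
      refine .inr ⟨s, hs, hls, x, hx, y, hy, hyx.symm, fun z hz => ⟨fun hpz => ?_, ?_⟩⟩
      · have := htt' x hx hpx
        have := htt' y hy hpy
        have := htt' z hz hpz
        grind
      · rintro (rfl | rfl)
        exacts [hpx, hpy]
  · push Not at hex
    have hS : (G.induce {x | lay x < j ∨ x = p ∨ x = q ∨ x = r}).Preconnected :=
      hL.preconnected_of_le (fun v hv => .inl hv) fun v hv => by
        rcases hv with hv | rfl | rfl | rfl <;> omega
    obtain ⟨T, hTS, hT, hsT, hpT, ht⟩ := exists_preconnected_unique_adj hS (.inr (.inl rfl))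
      hs.connected (fun x hx => (hls x hx).imp_right .inr) hps hex
    refine .inl ⟨T, hT, hsT hs.left_mem, hsT hs.right_mem, fun x hx => ?_, ht⟩
    exact (hTS hx).imp_right fun h => h.resolve_left fun hxp => hpT (hxp ▸ hx)

end IsLayering

/-- The hole formed by `a` and the paths `B` and `A` lies in layer `j + 1`, except for the end `p`
of `A`, which lies in layer `j`. Two legs join it to further vertices `q` and `r` of layer `j`: the
edge from `b` to `q` and the path `D` from `a` to `r`. -/
structure LeggedHole (G : SimpleGraph V) (lay : V → ℕ) (j : ℕ) where
  (p q r a a' b v d : V)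
  (A B D : Set V)
  lay_p : lay p = j
  lay_q : lay q = j
  lay_r : lay r = j
  lay_eq : ∀ x ∈ insert a (A ∪ B ∪ D), x ≠ p → x ≠ r → lay x = j + 1
  isIndPath_A : IsIndPath G A p a'
  isIndPath_B : IsIndPath G B b v
  isIndPath_D : IsIndPath G D r d
  p_ne_q : p ≠ q
  v_ne_b : v ≠ b
  adj_a_a' : G.Adj a a'
  adj_a_b : G.Adj a b
  adj_a_d : G.Adj a d
  adj_p_v : G.Adj p v
  adj_b_q : G.Adj b q
  joined_a_A : JoinedOnlyBy G {a} A a a'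
  joined_a_B : JoinedOnlyBy G {a} B a b
  joined_a_D : JoinedOnlyBy G {a} D a d
  joined_A_B : JoinedOnlyBy G A B p v
  joined_A_D : JoinedOnlyBy G A D p r
  anticomplete_B_D : ∀ x ∈ B, ∀ y ∈ D, x ≠ y ∧ ¬ G.Adj x y
  adj_q : ∀ x ∈ insert a (A ∪ B ∪ D), G.Adj x q → x = p ∨ x = b ∨ x = r

namespace LeggedHole

variable {lay : V → ℕ} {j : ℕ} (H : LeggedHole G lay j)

theorem p_ne_r : H.p ≠ H.r :=
  (H.joined_A_D _ H.isIndPath_A.left_mem _ H.isIndPath_D.left_mem).1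

theorem lay_a : lay H.a = j + 1 :=
  H.lay_eq _ (.inl rfl) (H.joined_a_A _ rfl _ H.isIndPath_A.left_mem).1
    (H.joined_a_D _ rfl _ H.isIndPath_D.left_mem).1

theorem lay_of_mem_A {x : V} (hx : x ∈ H.A) (hxp : x ≠ H.p) : lay x = j + 1 :=
  H.lay_eq _ (.inr (.inl (.inl hx))) hxp (H.joined_A_D x hx _ H.isIndPath_D.left_mem).1

theorem lay_of_mem_B {x : V} (hx : x ∈ H.B) : lay x = j + 1 :=
  H.lay_eq _ (.inr (.inl (.inr hx))) (H.joined_A_B _ H.isIndPath_A.left_mem x hx).1.symm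
    (H.anticomplete_B_D x hx _ H.isIndPath_D.left_mem).1

theorem lay_of_mem_D {x : V} (hx : x ∈ H.D) (hxr : x ≠ H.r) : lay x = j + 1 :=
  H.lay_eq _ (.inr (.inr hx)) (H.joined_A_D _ H.isIndPath_A.left_mem x hx).1.symm hxr

theorem lay_le_of_upper {y : V} (hy : lay y < j ∨ y = H.q ∨ y = H.r) : lay y ≤ j := by
  rcases hy with hy | rfl | rfl
  exacts [hy.le, H.lay_q.le, H.lay_r.le]

theorem adj_upper (hL : IsLayering G lay) {x y : V} (hx : x ∈ insert H.a (H.A ∪ H.B ∪ H.D))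
    (hlx : lay x = j + 1) (hy : lay y < j ∨ y = H.q ∨ y = H.r) (hxy : G.Adj x y) :
    x = H.b ∧ y = H.q ∨ y = H.r := by
  rcases hy with hy | rfl | rfl
  · have := hL.le_add_one hxy
    omega
  · rcases H.adj_q x hx hxy with rfl | rfl | rfl
    · have := H.lay_p
      omega
    · exact .inl ⟨rfl, rfl⟩
    · have := H.lay_r
      omega
  · exact .inr rfl

theorem adj_a_upper (hL : IsLayering G lay) {y : V} (hy : lay y < j ∨ y = H.q ∨ y = H.r)
    (hay : G.Adj H.a y) : y = H.d := by
  rcases H.adj_upper hL (.inl rfl) H.lay_a hy hay with ⟨hab, -⟩ | rfl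
  · exact absurd hab H.adj_a_b.ne
  · exact ((H.joined_a_D _ rfl _ H.isIndPath_D.left_mem).2 hay).2

theorem adj_B_upper (hL : IsLayering G lay) {x y : V} (hx : x ∈ H.B)
    (hy : lay y < j ∨ y = H.q ∨ y = H.r) (hxy : G.Adj x y) : x = H.b ∧ y = H.q :=
  (H.adj_upper hL (.inr (.inl (.inr hx))) (H.lay_of_mem_B hx) hy hxy).resolve_right
    fun hyr => (H.anticomplete_B_D x hx _ H.isIndPath_D.left_mem).2 (hyr ▸ hxy)

theorem adj_A_upper (hL : IsLayering G lay) {x y : V} (hx : x ∈ H.A)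
    (hy : lay y < j ∨ y = H.q ∨ y = H.r) (hxy : G.Adj x y) : x = H.p := by
  by_contra hxp
  rcases H.adj_upper hL (.inr (.inl (.inl hx))) (H.lay_of_mem_A hx hxp) hy hxy with
    ⟨rfl, -⟩ | rfl
  · exact (H.joined_A_B _ hx _ H.isIndPath_B.left_mem).1 rfl
  · exact hxp ((H.joined_A_D x hx _ H.isIndPath_D.left_mem).2 hxy).1

theorem notMem_A_of_upper {y : V} (hy : lay y < j ∨ y = H.q ∨ y = H.r) : y ∉ H.A := fun hA => by
  have hle := H.lay_le_of_upper hy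
  by_cases hyp : y = H.p
  · subst hyp
    rcases hy with hy | hy | hy
    exacts [hy.ne H.lay_p, H.p_ne_q hy, H.p_ne_r hy]
  · have := H.lay_of_mem_A hA hyp
    omega

theorem isIndCycle : IsIndCycle G H.a (H.B ∪ H.A) H.b H.a' where
  isIndPath := H.isIndPath_B.join H.isIndPath_A H.adj_p_v.symm H.joined_A_B.symm
  notMem h := h.elim (fun h => (H.joined_a_B _ rfl _ h).1 rfl)
    fun h => (H.joined_a_A _ rfl _ h).1 rfl
  adj_iff x hx := by
    refine ⟨fun h => ?_, ?_⟩
    · exact hx.imp (fun hx => ((H.joined_a_B _ rfl x hx).2 h).2)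
        fun hx => ((H.joined_a_A _ rfl x hx).2 h).2
    · rintro (rfl | rfl)
      exacts [H.adj_a_b, H.adj_a_a']

theorem isIndCycle_of_isIndPath (hL : IsLayering G lay) {s : Set V} (hs : IsIndPath G s H.q H.r)
    (hls : ∀ x ∈ s, lay x < j ∨ x = H.q ∨ x = H.r) :
    IsIndCycle G H.a (insert H.b (s ∪ H.D)) H.b H.d := by
  have hb := H.isIndPath_B.left_mem
  have hsD : MeetsOnlyAt G s H.D H.r := fun x hx y hy hxy => by
    by_contra! hne
    have hly := H.lay_of_mem_D hy hne.2
    rcases hxy with rfl | hxy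
    · have := H.lay_le_of_upper (hls x hx)
      omega
    · rcases H.adj_upper hL (.inr (.inr hy)) hly (hls x hx) hxy.symm with ⟨rfl, -⟩ | rfl
      · exact (H.anticomplete_B_D _ hb _ hy).1 rfl
      · exact hne.1 rfl
  refine ⟨.cons H.adj_b_q (hs.append H.isIndPath_D hsD) ?_ ?_, ?_, fun x hx => ⟨fun hax => ?_, ?_⟩⟩
  · rintro (h | h)
    · have := H.lay_le_of_upper (hls _ h)
      have := H.lay_of_mem_B hb
      omega
    · exact (H.anticomplete_B_D _ hb _ h).1 rfl
  · rintro x (hx | hx) hbx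
    · exact (H.adj_B_upper hL hb (hls x hx) hbx).2
    · exact absurd hbx (H.anticomplete_B_D _ hb x hx).2
  · rintro (h | h | h)
    · exact H.adj_a_b.ne h
    · have := H.lay_le_of_upper (hls _ h)
      have := H.lay_a
      omega
    · exact (H.joined_a_D _ rfl _ h).1 rfl
  · rcases hx with rfl | hx | hx
    · exact .inl rfl
    · exact .inr (H.adj_a_upper hL (hls x hx) hax)
    · exact .inr ((H.joined_a_D _ rfl x hx).2 hax).2
  · rintro (rfl | rfl)
    exacts [H.adj_a_b, H.adj_a_d]

theorem hasISK4_of_unique_adj (hL : IsLayering G lay) (htri : G.CliqueFree 3) {T : Set V}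
    (hT : (G.induce T).Preconnected) (hq : H.q ∈ T) (hr : H.r ∈ T)
    (hlT : ∀ x ∈ T, lay x < j ∨ x = H.q ∨ x = H.r) {t : V} (ht : t ∈ T) (hpt : G.Adj H.p t)
    (htu : ∀ y ∈ T, G.Adj H.p y → y = t) : HasISK4 G := by
  have hTD : (G.induce (T ∪ H.D)).Preconnected :=
    (induce_union_connected hT H.isIndPath_D.connected.preconnected
      ⟨H.r, hr, H.isIndPath_D.left_mem⟩).preconnected
  refine H.isIndCycle.hasISK4 htri (.inl H.isIndPath_B.left_mem) (.inr H.isIndPath_A.left_mem)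
    (H.joined_A_B _ H.isIndPath_A.left_mem _ H.isIndPath_B.left_mem).1.symm hTD ?_
    (.inr H.isIndPath_D.right_mem) (.inl hq) (.inl ht) H.adj_a_d H.adj_b_q hpt ?_
  · refine Set.disjoint_left.2 fun x hx hxT => ?_
    rcases hxT with hxT | hxD
    · have := H.lay_le_of_upper (hlT x hxT)
      rcases hx with rfl | hx | hx
      · have := H.lay_a
        omega
      · have := H.lay_of_mem_B hx
        omega
      · exact H.notMem_A_of_upper (hlT x hxT) hx
    · rcases hx with rfl | hx | hx
      exacts [(H.joined_a_D _ rfl _ hxD).1 rfl, (H.anticomplete_B_D _ hx _ hxD).1 rfl,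
        (H.joined_A_D _ hx _ hxD).1 rfl]
  · rintro x (rfl | hx | hx) y (hy | hy) hxy
    · exact .inl ⟨rfl, H.adj_a_upper hL (hlT y hy) hxy⟩
    · exact .inl ((H.joined_a_D _ rfl y hy).2 hxy)
    · exact .inr (.inl (H.adj_B_upper hL hx (hlT y hy) hxy))
    · exact absurd hxy (H.anticomplete_B_D x hx y hy).2
    · obtain rfl := H.adj_A_upper hL hx (hlT y hy) hxy
      exact .inr (.inr ⟨rfl, htu y hy hxy⟩)
    · obtain ⟨rfl, rfl⟩ := (H.joined_A_D x hx y hy).2 hxy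
      exact .inr (.inr ⟨rfl, htu _ hr hxy⟩)

theorem hasISK4_of_two_adj (hL : IsLayering G lay) (htri : G.CliqueFree 3) {s : Set V}
    (hs : IsIndPath G s H.q H.r) (hls : ∀ x ∈ s, lay x < j ∨ x = H.q ∨ x = H.r) {t t' : V}
    (ht : t ∈ s) (ht' : t' ∈ s) (htt' : t ≠ t') (hp : ∀ y ∈ s, G.Adj H.p y ↔ y = t ∨ y = t') :
    HasISK4 G := by
  have hpA := H.isIndPath_A.left_mem
  refine (H.isIndCycle_of_isIndPath hL hs hls).hasISK4 htri (.inr (.inl ht)) (.inr (.inl ht')) htt'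
    H.isIndPath_A.connected.preconnected ?_ H.isIndPath_A.right_mem hpA hpA H.adj_a_a'
    ((hp t ht).2 (.inl rfl)).symm ((hp t' ht').2 (.inr rfl)).symm ?_
  · refine Set.disjoint_left.2 fun x hx hxA => ?_
    rcases hx with rfl | rfl | hx | hx
    exacts [(H.joined_a_A _ rfl _ hxA).1 rfl, (H.joined_A_B _ hxA _ H.isIndPath_B.left_mem).1 rfl,
      H.notMem_A_of_upper (hls x hx) hxA, (H.joined_A_D _ hxA _ hx).1 rfl]
  · have hsp : ∀ x ∈ s, G.Adj x H.p → x = t ∧ H.p = H.p ∨ x = t' ∧ H.p = H.p := fun x hx hxp =>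
      ((hp x hx).1 hxp.symm).imp (⟨·, rfl⟩) (⟨·, rfl⟩)
    rintro x (rfl | rfl | hx | hx) y hy hxy
    · exact .inl ((H.joined_a_A _ rfl y hy).2 hxy)
    · have := (H.joined_A_B y hy _ H.isIndPath_B.left_mem).2 hxy.symm
      exact absurd this.2.symm H.v_ne_b
    · obtain rfl := H.adj_A_upper hL hy (hls x hx) hxy.symm
      exact .inr (hsp x hx hxy)
    · obtain ⟨rfl, rfl⟩ := (H.joined_A_D y hy x hx).2 hxy.symm
      exact .inr (hsp _ hs.right_mem hxy)

theorem hasISK4 (H : LeggedHole G lay j) (hL : IsLayering G lay) (htri : G.CliqueFree 3) :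
    HasISK4 G := by
  rcases hL.exists_confluence htri H.lay_p H.lay_q H.lay_r H.p_ne_q H.p_ne_r with
    ⟨T, hT, hq, hr, hlT, t, ht, hpt, htu⟩ | ⟨s, hs, hls, t, ht, t', ht', htt', hp⟩
  · exact H.hasISK4_of_unique_adj hL htri hT hq hr hlT ht hpt htu
  · exact H.hasISK4_of_two_adj hL htri hs hls ht ht' htt' hp

end LeggedHole

/-- The square `p a b c` has its vertex `p` in layer `j` and the other three in layer `j + 1`; the
vertex `q` is a neighbour in layer `j` of the vertex `b` opposite to `p`. -/
structure IsPeakedSquare (G : SimpleGraph V) (lay : V → ℕ) (j : ℕ) (p q a b c : V) : Prop where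
  lay_p : lay p = j
  lay_q : lay q = j
  lay_a : lay a = j + 1
  lay_b : lay b = j + 1
  lay_c : lay c = j + 1
  ne : a ≠ c
  adj_pa : G.Adj p a
  adj_pc : G.Adj p c
  adj_ab : G.Adj a b
  adj_bc : G.Adj b c
  adj_bq : G.Adj b q

namespace IsPeakedSquare

variable {lay : V → ℕ} {j : ℕ} {p q r a b c d : V}

theorem symm (h : IsPeakedSquare G lay j p q a b c) : IsPeakedSquare G lay j p q c b a :=
  ⟨h.lay_p, h.lay_q, h.lay_c, h.lay_b, h.lay_a, h.ne.symm, h.adj_pc, h.adj_pa, h.adj_bc.symm,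
    h.adj_ab.symm, h.adj_bq⟩

theorem hasISK4 (h : IsPeakedSquare G lay j p q a b c) (hL : IsLayering G lay)
    (htri : G.CliqueFree 3) {D : Set V} (hD : IsIndPath G D r d) (hr : lay r = j)
    (hlD : ∀ x ∈ D, x ≠ r → lay x = j + 1) (had : G.Adj a d) (haD : JoinedOnlyBy G {a} D a d)
    (hpD : JoinedOnlyBy G {p} D p r) (hbD : ∀ x ∈ ({b, c} : Set V), ∀ y ∈ D, x ≠ y ∧ ¬ G.Adj x y)
    (hqD : ∀ x ∈ D, G.Adj x q → x = r) : HasISK4 G := by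
  obtain ⟨hlp, hlq, hla, hlb, hlc, hac, hpa, hpc, hab, hbc, hbq⟩ := h
  have nac : ¬ G.Adj a c := not_adj_of_common_adj htri hab.symm hbc
  have npb : ¬ G.Adj p b := not_adj_of_common_adj htri hpa.symm hab
  have naq : ¬ G.Adj a q := not_adj_of_common_adj htri hab.symm hbq
  have ncq : ¬ G.Adj c q := not_adj_of_common_adj htri hbc hbq
  have H : LeggedHole G lay j := {
    p, q, r, a, a' := p, b, v := c, d, A := {p}, B := {b, c}, D
    lay_p := hlp
    lay_q := hlq
    lay_r := hr
    lay_eq := by grind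
    isIndPath_A := .single p
    isIndPath_B := .pair hbc
    isIndPath_D := hD
    p_ne_q := by grind [G.adj_comm]
    v_ne_b := hbc.ne'
    adj_a_a' := hpa.symm
    adj_a_b := hab
    adj_a_d := had
    adj_p_v := hpc
    adj_b_q := hbq
    joined_a_A := by grind [JoinedOnlyBy]
    joined_a_B := by grind [JoinedOnlyBy, hab.ne]
    joined_a_D := haD
    joined_A_B := by grind [JoinedOnlyBy]
    joined_A_D := hpD
    anticomplete_B_D := hbD
    adj_q := by grind }
  exact H.hasISK4 hL htri

theorem hasISK4_of_adj (h : IsPeakedSquare G lay j p q a b c) (hL : IsLayering G lay)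
    (htri : G.CliqueFree 3) (hr : lay r = j) (har : G.Adj a r) (hcr : ¬ G.Adj c r) :
    HasISK4 G := by
  have nbr : ¬ G.Adj b r := not_adj_of_common_adj htri h.adj_ab har
  refine h.hasISK4 hL htri (.single r) hr ?_ har ?_ ?_ ?_ ?_ <;>
    grind [JoinedOnlyBy, G.adj_comm, har.ne, h.lay_b, h.lay_c, h.adj_pc]

theorem hasISK4_of_path (h : IsPeakedSquare G lay j p q a b c) (hL : IsLayering G lay)
    (htri : G.CliqueFree 3) (hr : lay r = j) (hd : lay d = j + 1) (had : G.Adj a d)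
    (hdr : G.Adj d r) (hbd : b ≠ d) (hcd : c ≠ d) (nbr : ¬ G.Adj b r) (ncr : ¬ G.Adj c r)
    (ncd : ¬ G.Adj c d) (nqd : ¬ G.Adj q d) : HasISK4 G := by
  have nar : ¬ G.Adj a r := not_adj_of_common_adj htri had.symm hdr
  have nbd : ¬ G.Adj b d := not_adj_of_common_adj htri h.adj_ab had
  have npd : ¬ G.Adj p d := not_adj_of_common_adj htri h.adj_pa.symm had
  refine h.hasISK4 hL htri (.pair hdr.symm) hr ?_ had ?_ ?_ ?_ ?_ <;>
    grind [JoinedOnlyBy, G.adj_comm, had.ne, h.lay_p, h.lay_a, h.lay_b, h.lay_c, h.adj_pc]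

end IsPeakedSquare

/-- The vertices `c 0, …, c ℓ` form an induced path, in this order. -/
structure IsIndSeq (G : SimpleGraph V) (c : ℕ → V) (ℓ : ℕ) : Prop where
  adj : ∀ {i}, i < ℓ → G.Adj (c i) (c (i + 1))
  ne : ∀ {i k}, i < k → k ≤ ℓ → c i ≠ c k
  not_adj : ∀ {i k}, i + 1 < k → k ≤ ℓ → ¬ G.Adj (c i) (c k)

theorem IsIndSeq.shift {c : ℕ → V} {ℓ m : ℕ} (h : IsIndSeq G c ℓ) (i : ℕ) (hm : m + i ≤ ℓ) :
    IsIndSeq G (fun k => c (k + i)) m where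
  adj hk := by simpa only [Nat.add_right_comm] using h.adj (by omega)
  ne hk hk' := h.ne (by omega) (by omega)
  not_adj hk hk' := h.not_adj (by omega) (by omega)

theorem IsIndSeq.joinedOnlyBy {c : ℕ → V} {m : ℕ} (h : IsIndSeq G c (m + 1)) :
    JoinedOnlyBy G {c 0} ((fun k => c (k + 1)) '' Set.Iic m) (c 0) (c 1) := by
  rintro _ rfl _ ⟨k, hk, rfl⟩
  have hk := Nat.succ_le_succ (Set.mem_Iic.1 hk)
  refine ⟨h.ne k.succ_pos hk, fun hadj => ⟨rfl, ?_⟩⟩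
  by_contra hne
  have : k ≠ 0 := fun e => hne (e ▸ rfl)
  exact h.not_adj (by omega) hk hadj

theorem IsIndSeq.isIndPath {c : ℕ → V} {ℓ : ℕ} (h : IsIndSeq G c ℓ) :
    IsIndPath G (c '' Set.Iic ℓ) (c 0) (c ℓ) := by
  induction ℓ with
  | zero =>
    simp only [Set.Iic, Nat.le_zero, Set.ofPred_eq_eq_singleton, Set.image_singleton]
    exact .single (c 0)
  | succ ℓ ih =>
    rw [show Set.Iic (ℓ + 1) = insert (ℓ + 1) (Set.Iic ℓ) from Order.Iic_succ ℓ,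
      Set.image_insert_eq]
    refine (IsIndPath.cons (h.adj ℓ.lt_succ_self).symm (ih (h.shift 0 ℓ.le_succ)).symm ?_ ?_).symm
    · rintro ⟨i, hi, hi'⟩
      exact h.ne (Nat.lt_succ_of_le hi) le_rfl hi'
    · rintro _ ⟨i, hi, rfl⟩ hadj
      by_contra hne
      have : i ≠ ℓ := fun e => hne (e ▸ rfl)
      exact h.not_adj (Nat.succ_lt_succ (lt_of_le_of_ne hi this)) le_rfl hadj.symm

theorem IsLayering.exists_adj_lay_eq {lay : V → ℕ} (hL : IsLayering G lay) {v : V} {j : ℕ}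
    (hv : lay v = j + 1) : ∃ w, G.Adj w v ∧ lay w = j := by
  obtain ⟨w, hvw, hw⟩ := hL.exists_parent (v := v) (by omega)
  exact ⟨w, hvw.symm, by omega⟩

/-- An ear: the vertices `c 0, …, c ℓ` of layer `j + 1` form an induced path of length at least
three, and of these the vertex `x` of layer `j` is adjacent to the ends only. -/
structure IsEar (G : SimpleGraph V) (lay : V → ℕ) (j ℓ : ℕ) (x : V) (c : ℕ → V) : Prop
    extends IsIndSeq G c ℓ where
  three_le : 3 ≤ ℓ
  lay_apex : lay x = j
  lay_eq : ∀ {i}, i ≤ ℓ → lay (c i) = j + 1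
  adj_iff : ∀ {i}, i ≤ ℓ → (G.Adj x (c i) ↔ i = 0 ∨ i = ℓ)

namespace IsEar

variable {lay : V → ℕ} {j ℓ i k : ℕ} {x y z : V} {c : ℕ → V}

theorem adj_zero (h : IsEar G lay j ℓ x c) : G.Adj x (c 0) :=
  (h.adj_iff (Nat.zero_le ℓ)).2 (.inl rfl)

theorem adj_last (h : IsEar G lay j ℓ x c) : G.Adj x (c ℓ) :=
  (h.adj_iff le_rfl).2 (.inr rfl)

theorem not_adj_inner (h : IsEar G lay j ℓ x c) (hi : 0 < i) (hiℓ : i < ℓ) : ¬ G.Adj x (c i) :=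
  fun hxi => by
    have := (h.adj_iff hiℓ.le).1 hxi
    omega

theorem adj_add_two (h : IsEar G lay j ℓ x c) (htri : G.CliqueFree 3)
    (hmin : ∀ m < ℓ, ∀ w c', ¬ IsEar G lay j m w c') (hy : lay y = j) (hi : 0 < i) (hik : i < k)
    (hk : k ≤ ℓ) (hyi : G.Adj y (c i)) (hyk : G.Adj y (c k)) :
    i + 2 ≤ ℓ ∧ G.Adj y (c (i + 2)) := by
  classical
  have hex : ∃ n, i < n ∧ n ≤ ℓ ∧ G.Adj y (c n) := ⟨k, hik, hk, hyk⟩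
  obtain ⟨hin, hnℓ, hyn⟩ := Nat.find_spec hex
  have hfirst := fun m => Nat.find_min hex (m := m)
  generalize Nat.find hex = n at *
  have hn : n ≠ i + 1 := by
    rintro rfl
    exact not_adj_of_common_adj htri hyi hyn (h.adj hnℓ)
  by_cases hn2 : n = i + 2
  · subst hn2
    exact ⟨hnℓ, hyn⟩
  refine absurd ⟨h.shift (m := n - i) i (by omega), by omega, hy, fun hm => h.lay_eq (by omega),
    fun {m} hm => ⟨fun hym => ?_, ?_⟩⟩ (hmin (n - i) (by omega) y fun k => c (k + i))
  · by_contra! hmn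
    exact hfirst (m + i) (by omega) ⟨by omega, by omega, hym⟩
  · rintro (rfl | rfl)
    · rwa [Nat.zero_add]
    · rwa [Nat.sub_add_cancel hin.le]

theorem not_adj_zero_of_adj_two (h : IsEar G lay j ℓ x c) (hL : IsLayering G lay)
    (htri : G.CliqueFree 3) (hfree : ¬ HasISK4 G) (hy : lay y = j) (hy2 : G.Adj y (c 2)) :
    ¬ G.Adj y (c 0) := fun hy0 => by
  have hℓ := h.three_le
  obtain ⟨z, hz1, hz⟩ := hL.exists_adj_lay_eq (h.lay_eq (i := 1) (by omega))
  have hsq : IsPeakedSquare G lay j y z (c 0) (c 1) (c 2) :=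
    ⟨hy, hz, h.lay_eq (by omega), h.lay_eq (by omega), h.lay_eq (by omega),
      h.ne (by omega) (by omega), hy0, hy2, h.adj (by omega), h.adj (by omega), hz1.symm⟩
  exact hfree (hsq.hasISK4_of_adj hL htri h.lay_apex h.adj_zero.symm
    fun h2 => h.not_adj_inner (by omega) (by omega) h2.symm)

theorem eq_one_of_adj (h : IsEar G lay j ℓ x c) (hL : IsLayering G lay) (htri : G.CliqueFree 3)
    (hfree : ¬ HasISK4 G) (hmin : ∀ m < ℓ, ∀ w c', ¬ IsEar G lay j m w c') (hz : lay z = j)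
    (hz1 : G.Adj z (c 1)) (hk : k ≤ ℓ) (hzk : G.Adj z (c k)) : k = 1 := by
  have hℓ := h.three_le
  by_contra hk1
  rcases Nat.eq_zero_or_pos k with rfl | hk0
  · exact not_adj_of_common_adj htri hzk hz1 (h.adj (by omega))
  obtain ⟨-, hz3⟩ := h.adj_add_two htri hmin hz one_pos (by omega) hk hz1 hzk
  obtain ⟨y, hy2, hy⟩ := hL.exists_adj_lay_eq (h.lay_eq (i := 2) (by omega))
  have hsq : IsPeakedSquare G lay j z y (c 1) (c 2) (c 3) :=
    ⟨hz, hy, h.lay_eq (by omega), h.lay_eq (by omega), h.lay_eq (by omega),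
      h.ne (by omega) (by omega), hz1, hz3, h.adj (by omega), h.adj (by omega), hy2.symm⟩
  have inner : ∀ {i}, 0 < i → i < ℓ → ¬ G.Adj (c i) x := fun hi hiℓ hix =>
    h.not_adj_inner hi hiℓ hix.symm
  refine hfree ?_
  rcases hℓ.eq_or_lt with rfl | hℓ
  · exact hsq.symm.hasISK4_of_adj hL htri h.lay_apex h.adj_last.symm (inner one_pos (by omega))
  · exact hsq.hasISK4_of_path hL htri h.lay_apex (h.lay_eq (Nat.zero_le ℓ))
      (h.adj (by omega)).symm h.adj_zero.symm (h.ne (by omega) (by omega)).symm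
      (h.ne (by omega) (by omega)).symm (inner two_pos (by omega)) (inner three_pos (by omega))
      (fun h' => h.not_adj (by omega) (by omega) h'.symm)
      (h.not_adj_zero_of_adj_two hL htri hfree hy hy2)

theorem eq_two_of_adj (h : IsEar G lay j ℓ x c) (hL : IsLayering G lay) (htri : G.CliqueFree 3)
    (hfree : ¬ HasISK4 G) (hmin : ∀ m < ℓ, ∀ w c', ¬ IsEar G lay j m w c') (hy : lay y = j)
    (hy2 : G.Adj y (c 2)) (hk : k ≤ ℓ) (hyk : G.Adj y (c k)) : k = 2 := by
  have hℓ := h.three_le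
  have eq_one : ∀ {z k}, lay z = j → G.Adj z (c 1) → k ≤ ℓ → G.Adj z (c k) → k = 1 :=
    h.eq_one_of_adj hL htri hfree hmin
  by_contra hk2
  have hk0 : k ≠ 0 := by
    rintro rfl
    exact h.not_adj_zero_of_adj_two hL htri hfree hy hy2 hyk
  have hk1 : k ≠ 1 := by
    rintro rfl
    exact not_adj_of_common_adj htri hyk hy2 (h.adj (by omega))
  obtain ⟨hℓ4, hy4⟩ := h.adj_add_two htri hmin hy two_pos (by omega) hk hy2 hyk
  obtain ⟨z, hz1, hz⟩ := hL.exists_adj_lay_eq (h.lay_eq (i := 1) (by omega))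
  obtain ⟨w, hw3, hw⟩ := hL.exists_adj_lay_eq (h.lay_eq (i := 3) (by omega))
  have hsq : IsPeakedSquare G lay j y w (c 2) (c 3) (c 4) :=
    ⟨hy, hw, h.lay_eq (by omega), h.lay_eq (by omega), h.lay_eq (by omega),
      h.ne (by omega) (by omega), hy2, hy4, h.adj (by omega), h.adj (by omega), hw3.symm⟩
  refine hfree (hsq.hasISK4_of_path hL htri hz (h.lay_eq (i := 1) (by omega))
    (h.adj (by omega)).symm hz1.symm (h.ne (by omega) (by omega)).symm
    (h.ne (by omega) (by omega)).symm (fun h3 => ?_) (fun h4 => ?_)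
    (fun h' => h.not_adj (by omega) (by omega) h'.symm) fun hw1 => ?_)
  · exact absurd (eq_one hz hz1 (by omega) h3.symm) (by omega)
  · exact absurd (eq_one hz hz1 (by omega) h4.symm) (by omega)
  · exact absurd (eq_one hw hw1 (by omega) hw3) (by omega)

theorem lay_ne (h : IsEar G lay j ℓ x c) (hy : lay y = j) (hi : i ≤ ℓ) : y ≠ c i := by
  rintro rfl
  have := h.lay_eq hi
  omega

theorem joinedOnlyBy {m : ℕ} (h : IsEar G lay j (m + 2) x c) :
    JoinedOnlyBy G {x, c 0} ((fun k => c (k + 2)) '' Set.Iic m) x (c (m + 2)) := by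
  rintro u (rfl | rfl) _ ⟨k, hk, rfl⟩ <;> have hk := Nat.add_le_add_right hk 2
  · refine ⟨h.lay_ne h.lay_apex hk, fun hxk => ⟨rfl, congrArg c ?_⟩⟩
    exact ((h.adj_iff hk).1 hxk).resolve_left (Nat.succ_ne_zero _)
  · exact ⟨h.ne (by omega) hk, fun h0 => absurd h0 (h.not_adj (by omega) hk)⟩

theorem hasISK4_of_unique_adj (h : IsEar G lay j ℓ x c) (hL : IsLayering G lay)
    (htri : G.CliqueFree 3) (hy : lay y = j) (hz : lay z = j) (hy2 : G.Adj y (c 2))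
    (hz1 : G.Adj z (c 1)) (hyu : ∀ {k}, k ≤ ℓ → G.Adj y (c k) → k = 2)
    (hzu : ∀ {k}, k ≤ ℓ → G.Adj z (c k) → k = 1) : HasISK4 G := by
  obtain ⟨m, rfl⟩ : ∃ m, ℓ = m + 2 := Nat.exists_eq_add_of_le' (by have := h.three_le; omega)
  have hm := h.three_le
  have hx : lay x = j := h.lay_apex
  have hx1 : ¬ G.Adj x (c 1) := h.not_adj_inner one_pos (by omega)
  have hne : ∀ {w k}, lay w = j → k ≤ m + 2 → w ≠ c k := h.lay_ne
  have hz0 : ¬ G.Adj z (c 0) := fun hz0 => zero_ne_one (hzu (Nat.zero_le _) hz0)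
  have hy0 : ¬ G.Adj y (c 0) := fun hy0 => absurd (hyu (Nat.zero_le _) hy0) (by omega)
  have hy1 : ¬ G.Adj y (c 1) := fun hy1 => absurd (hyu (by omega) hy1) (by omega)
  have H : LeggedHole G lay j := {
    p := x, q := y, r := z, a := c 1, a' := c 0, b := c 2, v := c (m + 2), d := z
    A := {x, c 0}, B := (fun k => c (k + 2)) '' Set.Iic m, D := {z}
    lay_p := hx
    lay_q := hy
    lay_r := hz
    lay_eq := by grind [h.lay_eq]
    isIndPath_A := .pair h.adj_zero
    isIndPath_B := (h.shift 2 le_rfl).isIndPath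
    isIndPath_D := .single z
    p_ne_q := fun e => hy0 (e ▸ h.adj_zero)
    v_ne_b := (h.ne (by omega) le_rfl).symm
    adj_a_a' := (h.adj (by omega)).symm
    adj_a_b := h.adj (by omega)
    adj_a_d := hz1.symm
    adj_p_v := h.adj_last
    adj_b_q := hy2.symm
    joined_a_A := by grind [JoinedOnlyBy, G.adj_comm, h.ne one_pos (show 1 ≤ m + 2 by omega)]
    joined_a_B := (h.shift 1 le_rfl).joinedOnlyBy
    joined_a_D := by grind [JoinedOnlyBy]
    joined_A_B := h.joinedOnlyBy
    joined_A_D := by grind [JoinedOnlyBy, G.adj_comm, h.adj_zero]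
    anticomplete_B_D := by grind [G.adj_comm]
    adj_q := by grind [G.adj_comm] }
  exact H.hasISK4 hL htri

theorem hasISK4 (h : IsEar G lay j ℓ x c) (hL : IsLayering G lay) (htri : G.CliqueFree 3) :
    HasISK4 G := by
  by_contra hfree
  induction ℓ using Nat.strong_induction_on generalizing x c with
  | _ ℓ hmin =>
    have hℓ := h.three_le
    obtain ⟨y, hy2, hy⟩ := hL.exists_adj_lay_eq (h.lay_eq (i := 2) (by omega))
    obtain ⟨z, hz1, hz⟩ := hL.exists_adj_lay_eq (h.lay_eq (i := 1) (by omega))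
    have hmin : ∀ m < ℓ, ∀ w c', ¬ IsEar G lay j m w c' := fun m hm _ _ h => hmin m hm h
    exact hfree (h.hasISK4_of_unique_adj hL htri hy hz hy2 hz1
      (h.eq_two_of_adj hL htri hfree hmin hy hy2) (h.eq_one_of_adj hL htri hfree hmin hz hz1))

end IsEar

/-- A closed walk of length `n`, repeated periodically. -/
structure IsClosedSeq (G : SimpleGraph V) (c : ℕ → V) (n : ℕ) : Prop where
  periodic : Function.Periodic c n
  adj : ∀ i, G.Adj (c i) (c (i + 1))

/-- An induced cycle of length `n`, repeated periodically: any `n - 1` consecutive vertices form an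
induced path. -/
structure IsIndCycleSeq (G : SimpleGraph V) (c : ℕ → V) (n : ℕ) : Prop
    extends IsClosedSeq G c n where
  isIndSeq : ∀ i {m}, m + 2 ≤ n → IsIndSeq G (fun k => c (k + i)) m

theorem exists_isClosedSeq {u : V} (w : G.Walk u u) (hw : w.length ≠ 0) :
    ∃ c, IsClosedSeq G c w.length := by
  refine ⟨fun i => w.getVert (i % w.length), fun i => by rw [Nat.add_mod_right], fun i => ?_⟩
  have hi := Nat.mod_lt i (Nat.pos_of_ne_zero hw)
  have hadj := w.adj_getVert_succ hi
  rw [← Nat.mod_add_mod]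
  rcases (Nat.succ_le_of_lt hi).lt_or_eq with h | h
  · rwa [Nat.mod_eq_of_lt h]
  · rw [Nat.succ_eq_add_one] at h
    rw [h, w.getVert_length] at hadj
    rwa [h, Nat.mod_self, w.getVert_zero]

theorem IsClosedSeq.exists_walk {c : ℕ → V} {n : ℕ} (h : IsClosedSeq G c n) (i d : ℕ) :
    ∃ w : G.Walk (c i) (c (i + d)), w.length = d := by
  induction d with
  | zero => exact ⟨.nil, rfl⟩
  | succ d ih =>
    obtain ⟨w, hw⟩ := ih
    exact ⟨w.concat (h.adj (i + d)), by rw [Walk.length_concat, hw]⟩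

/- The walk closes one of the two arcs between its ends to an odd closed walk. -/
theorem IsClosedSeq.le_length {c : ℕ → V} {n : ℕ} (h : IsClosedSeq G c n) (hn : Odd n)
    (hmin : ∀ (u : V) (w : G.Walk u u), Odd w.length → n ≤ w.length) {i d : ℕ} (hd : d ≤ n)
    (w : G.Walk (c i) (c (i + d))) : d ≤ w.length ∨ n ≤ d + w.length := by
  obtain ⟨w₁, hw₁⟩ := h.exists_walk i d
  obtain ⟨w₂, hw₂⟩ := h.exists_walk (i + d) (n - d)
  have hend : c (i + d + (n - d)) = c i := by
    rw [add_assoc, Nat.add_sub_cancel' hd, h.periodic]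
  have h₁ := hmin _ (w₁.append w.reverse)
  have h₂ := hmin _ ((w₂.copy rfl hend).append w)
  simp only [Walk.length_append, Walk.length_reverse, Walk.length_copy, hw₁, hw₂] at h₁ h₂
  grind

theorem IsClosedSeq.isIndCycleSeq {c : ℕ → V} {n : ℕ} (h : IsClosedSeq G c n) (hn : Odd n)
    (hmin : ∀ (u : V) (w : G.Walk u u), Odd w.length → n ≤ w.length) : IsIndCycleSeq G c n where
  toIsClosedSeq := h
  isIndSeq i m hm := by
    have far : ∀ {k l}, k < l → l ≤ m → ∀ w : G.Walk (c (k + i)) (c (l + i)),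
        w.length ≤ 1 → l ≤ k + w.length := fun {k l} hk hl w hw => by
      have hkl : k + i + (l - k) = l + i := by omega
      have := h.le_length hn hmin (by omega) (w.copy rfl (congrArg c hkl.symm))
      rw [Walk.length_copy] at this
      omega
    refine ⟨fun {k} _ => ?_, fun {k l} hk hl hkl => ?_, fun {k l} hk hl hkl => ?_⟩
    · simpa only [Nat.add_right_comm] using h.adj (k + i)
    · have := far hk hl (Walk.nil.copy rfl hkl) (by simp)
      rw [Walk.length_copy, Walk.length_nil] at this
      omega
    · have := far (by omega) hl (Walk.cons hkl .nil) (by simp)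
      rw [Walk.length_cons, Walk.length_nil] at this
      omega

theorem exists_isIndCycleSeq (h : ¬ G.Colorable 2) : ∃ c n, Odd n ∧ IsIndCycleSeq G c n := by
  classical
  rw [two_colorable_iff_forall_loop_even] at h
  push Not at h
  have hex : ∃ n, ∃ (u : V) (w : G.Walk u u), w.length = n ∧ Odd n := by
    obtain ⟨u, w, hw⟩ := h
    exact ⟨_, u, w, rfl, Nat.not_even_iff_odd.1 hw⟩
  obtain ⟨u, w, hw, hn⟩ := Nat.find_spec hex
  obtain ⟨c, hc⟩ := exists_isClosedSeq w (hw ▸ hn.pos.ne')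
  exact ⟨c, _, hn, (hw ▸ hc).isIndCycleSeq hn fun u w hw => Nat.find_min' hex ⟨u, w, rfl, hw⟩⟩

theorem exists_odd_gap {P : ℕ → Prop} {n : ℕ} (hn : Odd n) {a : ℕ} (ha : P a) (han : P (a + n)) :
    ∃ e ℓ, Odd ℓ ∧ ℓ ≤ n ∧ P e ∧ P (e + ℓ) ∧ ∀ m, 0 < m → m < ℓ → ¬ P (e + m) := by
  induction n using Nat.strong_induction_on generalizing a with
  | _ n ih =>
    by_cases hgap : ∀ m, 0 < m → m < n → ¬ P (a + m)
    · exact ⟨a, n, hn, le_rfl, ha, han, hgap⟩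
    push Not at hgap
    obtain ⟨m, hm0, hmn, hm⟩ := hgap
    obtain ⟨e, ℓ, hℓ, hle, h⟩ : ∃ e ℓ, Odd ℓ ∧ ℓ < n ∧ P e ∧ P (e + ℓ) ∧
        ∀ m, 0 < m → m < ℓ → ¬ P (e + m) := by
      rcases Nat.even_or_odd m with hme | hmo
      · obtain ⟨e, ℓ, hℓ, hle, h⟩ := ih (n - m) (by omega) (Nat.Odd.sub_even hmn.le hn hme) hm
          (by rwa [add_assoc, Nat.add_sub_cancel' hmn.le])
        exact ⟨e, ℓ, hℓ, by omega, h⟩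
      · obtain ⟨e, ℓ, hℓ, hle, h⟩ := ih m hmn hmo ha hm
        exact ⟨e, ℓ, hℓ, by omega, h⟩
    exact ⟨e, ℓ, hℓ, hle.le, h⟩

namespace IsIndCycleSeq

variable {c : ℕ → V} {n : ℕ}

theorem map {W : Type*} {H : SimpleGraph W} (f : H ↪g G) {c : ℕ → W} (h : IsIndCycleSeq H c n) :
    IsIndCycleSeq G (f ∘ c) n where
  periodic := h.periodic.comp f
  adj i := f.map_adj_iff.2 (h.adj i)
  isIndSeq i _ hm :=
    have hs := h.isIndSeq i hm
    ⟨fun hk => f.map_adj_iff.2 (hs.adj hk), fun hk hl e => hs.ne hk hl (f.injective e),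
      fun hk hl hkl => hs.not_adj hk hl (f.map_adj_iff.1 hkl)⟩

theorem isIndCycle {m : ℕ} (h : IsIndCycleSeq G c (m + 2)) :
    IsIndCycle G (c 0) ((fun k => c (k + 1)) '' Set.Iic m) (c 1) (c (m + 1)) := by
  have hlast : G.Adj (c (m + 1)) (c 0) := by
    have := h.adj (m + 1)
    rwa [← h.periodic 0, Nat.zero_add]
  have hinit : IsIndSeq G c m := h.isIndSeq 0 le_rfl
  refine ⟨(h.isIndSeq 1 le_rfl).isIndPath, ?_, ?_⟩
  · rintro ⟨k, hk, hk0⟩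
    rcases (Set.mem_Iic.1 hk).eq_or_lt with rfl | hk
    · exact hlast.ne hk0
    · exact hinit.ne k.succ_pos hk hk0.symm
  · rintro _ ⟨k, hk, rfl⟩
    refine ⟨fun hadj => ?_, ?_⟩
    · by_contra! hne
      have hk0 : k ≠ 0 := fun e => hne.1 (e ▸ rfl)
      have hkm : k ≠ m := fun e => hne.2 (e ▸ rfl)
      exact hinit.not_adj (by omega) (Nat.succ_le_of_lt (lt_of_le_of_ne hk hkm)) hadj
    · rintro (e | e)
      exacts [e ▸ h.adj 0, e ▸ hlast.symm]

variable {lay : V → ℕ} {j : ℕ} {x : V}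

theorem not_adj_add (h : IsIndCycleSeq G c n) (hn : Odd n) (hL : IsLayering G lay)
    (htri : G.CliqueFree 3) (hfree : ¬ HasISK4 G) (hc : ∀ i, lay (c i) = j + 1) (hx : lay x = j)
    {i d : ℕ} (hd : 0 < d) (hdn : d < n) (hxi : G.Adj x (c i)) : ¬ G.Adj x (c (i + d)) := by
  intro hxd
  obtain ⟨e, ℓ, hℓ, hℓn, hxe, hxℓ, hgap⟩ : ∃ e ℓ, Odd ℓ ∧ ℓ < n ∧ G.Adj x (c e) ∧
      G.Adj x (c (e + ℓ)) ∧ ∀ m, 0 < m → m < ℓ → ¬ G.Adj x (c (e + m)) := by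
    rcases Nat.even_or_odd d with hde | hdo
    · obtain ⟨e, ℓ, hℓ, hle, hgap⟩ := exists_odd_gap (P := fun m => G.Adj x (c m))
        (Nat.Odd.sub_even hdn.le hn hde) hxd
        (by rwa [add_assoc, Nat.add_sub_cancel' hdn.le, h.periodic])
      exact ⟨e, ℓ, hℓ, by omega, hgap⟩
    · obtain ⟨e, ℓ, hℓ, hle, hgap⟩ := exists_odd_gap (P := fun m => G.Adj x (c m)) hdo hxi hxd
      exact ⟨e, ℓ, hℓ, by omega, hgap⟩
  have hℓ1 : ℓ ≠ 1 := by
    rintro rfl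
    exact not_adj_of_common_adj htri hxe hxℓ (h.adj e)
  obtain ⟨a, rfl⟩ := hℓ
  obtain ⟨b, rfl⟩ := hn
  have ear : IsEar G lay j (2 * a + 1) x fun k => c (k + e) := by
    refine ⟨h.isIndSeq e (by omega), by omega, hx, fun _ => hc _, fun {i} hi => ⟨fun hxi => ?_, ?_⟩⟩
    · by_contra! hne
      exact hgap i (by omega) (by omega) (by rwa [add_comm e])
    · rintro (rfl | rfl)
      · rwa [Nat.zero_add]
      · rwa [add_comm _ e]
  exact hfree (ear.hasISK4 hL htri)

theorem eq_of_adj (h : IsIndCycleSeq G c n) (hn : Odd n) (hL : IsLayering G lay)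
    (htri : G.CliqueFree 3) (hfree : ¬ HasISK4 G) (hc : ∀ i, lay (c i) = j + 1) (hx : lay x = j)
    {i k : ℕ} (hi : G.Adj (c i) x) (hk : G.Adj (c k) x) : c i = c k := by
  wlog hik : i ≤ k generalizing i k
  · exact (this hk hi (le_of_not_ge hik)).symm
  have hmod : c k = c (i + (k - i) % n) := by
    have := (h.periodic.const_add i).map_mod_nat (k - i)
    rw [this, Nat.add_sub_cancel' hik]
  rcases Nat.eq_zero_or_pos ((k - i) % n) with h0 | h0
  · rw [hmod, h0, add_zero]
  · exact absurd (hmod ▸ hk.symm)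
      (h.not_adj_add hn hL htri hfree hc hx h0 (Nat.mod_lt _ hn.pos) hi.symm)

theorem hasISK4 (h : IsIndCycleSeq G c n) (hn : Odd n) (hL : IsLayering G lay)
    (htri : G.CliqueFree 3) (hc : ∀ i, lay (c i) = j + 1) : HasISK4 G := by
  by_contra hfree
  obtain ⟨x, hx, hlx⟩ := hL.exists_adj_lay_eq (hc 0)
  obtain ⟨y, hy, hly⟩ := hL.exists_adj_lay_eq (hc 1)
  obtain ⟨z, hz, hlz⟩ := hL.exists_adj_lay_eq (hc 2)
  have huniq : ∀ {w i k}, lay w = j → G.Adj (c i) w → G.Adj w (c k) → c i = c k :=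
    fun hw hi hk => h.eq_of_adj hn hL htri hfree hc hw hi hk.symm
  have hn1 : n ≠ 1 := by
    rintro rfl
    exact (h.adj 0).ne (h.periodic 0).symm
  obtain ⟨m, rfl⟩ : ∃ m, n = m + 2 := Nat.exists_eq_add_of_le' (by have := hn.pos; omega)
  have hT : (G.induce {v | lay v < j ∨ v = x ∨ v = y ∨ v = z}).Preconnected :=
    hL.preconnected_of_le (fun v hv => .inl hv) fun v hv => by
      rcases hv with hv | rfl | rfl | rfl <;> omega
  have hcyc : ∀ v ∈ insert (c 0) ((fun k => c (k + 1)) '' Set.Iic m), ∃ k, c k = v := by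
    rintro _ (rfl | ⟨k, -, rfl⟩)
    exacts [⟨0, rfl⟩, ⟨k + 1, rfl⟩]
  refine hfree (h.isIndCycle.hasISK4 htri ⟨0, Nat.zero_le m, rfl⟩
    ⟨1, Nat.one_le_iff_ne_zero.2 ?_, rfl⟩ (h.adj 1).ne hT ?_ (.inr (.inl rfl))
    (.inr (.inr (.inl rfl))) (.inr (.inr (.inr rfl))) hx.symm hy.symm hz.symm ?_)
  · rintro rfl
    exact absurd hn (by decide)
  · refine Set.disjoint_left.2 fun v hv hvT => ?_
    obtain ⟨k, rfl⟩ := hcyc v hv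
    have := hc k
    rcases hvT with hvT | hvT | hvT | hvT
    · omega
    all_goals
      rw [hvT] at this
      omega
  · intro u hu v hv huv
    obtain ⟨k, rfl⟩ := hcyc u hu
    rcases hv with hv | rfl | rfl | rfl
    · have := hL.le_add_one huv
      have := hc k
      omega
    · exact .inl ⟨huniq hlx huv hx, rfl⟩
    · exact .inr (.inl ⟨huniq hly huv hy, rfl⟩)
    · exact .inr (.inr ⟨huniq hlz huv hz, rfl⟩)

end IsIndCycleSeq

namespace IsLayering

variable {lay : V → ℕ}

theorem colorable_two_of_layer (hL : IsLayering G lay) (htri : G.CliqueFree 3)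
    (hfree : ¬ HasISK4 G) (k : ℕ) : (G.induce {v | lay v = k}).Colorable 2 := by
  by_contra hcol
  obtain ⟨c, n, hn, hc⟩ := exists_isIndCycleSeq hcol
  have hc' := hc.map (Embedding.induce {v | lay v = k})
  have hlay : ∀ i, lay (c i) = k := fun i => (c i).2
  rcases k with _ | j
  · exact (hc'.adj 0).ne (hL.root_unique (hlay 0) (hlay 1))
  · exact hfree (hc'.hasISK4 hn hL htri hlay)

theorem colorable_mul_two (hL : IsLayering G lay) {m : ℕ}
    (hcol : ∀ k, (G.induce {v | lay v = k}).Colorable m) : G.Colorable (m * 2) := by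
  have C := fun k => (hcol k).some
  have hC : ∀ {v k} (hv : lay v = k), C (lay v) ⟨v, rfl⟩ = C k ⟨v, hv⟩ := by
    rintro v _ rfl
    rfl
  have col : G.Coloring (Fin m × Fin 2) := Coloring.mk
    (fun v => (C (lay v) ⟨v, rfl⟩, ⟨lay v % 2, Nat.mod_lt _ two_pos⟩)) fun {u v} huv heq => by
      obtain ⟨hcolor, hpar⟩ := Prod.mk.inj heq
      have hpar := Fin.mk.inj hpar
      have huv' := hL.le_add_one huv
      have hvu := hL.le_add_one huv.symm
      have hlay : lay u = lay v := by omega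
      rw [hC hlay] at hcolor
      exact (C (lay v)).valid (v := ⟨u, hlay⟩) (w := ⟨v, rfl⟩) huv hcolor
  simpa using col.colorable

end IsLayering

end

theorem theorem1_general {V : Type*} (G : SimpleGraph V)
    (hISK4 : G.ISK4Free) (htriangle : G.CliqueFree 3) :
    G.chromaticNumber ≤ 4 := by
  refine SimpleGraph.Colorable.chromaticNumber_le (n := 4) ?_
  refine SimpleGraph.colorable_iff_forall_connectedComponent.2 fun C => ?_
  obtain ⟨u, hu⟩ := C.nonempty_supp
  have hL := isLayering_dist C.connected_toSimpleGraph ⟨u, hu⟩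
  have htri := htriangle.comap ⟨SimpleGraph.Copy.induce G C.supp⟩
  exact hL.colorable_mul_two
    (hL.colorable_two_of_layer htri fun h => h.of_induce.not_isk4Free hISK4)

theorem theorem1 {V : Type*} [Finite V] (G : SimpleGraph V)
    (hISK4 : G.ISK4Free) (htriangle : G.CliqueFree 3) :
    G.chromaticNumber ≤ 4 :=
  theorem1_general G hISK4 htriangle
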